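/- Let $\mathbb{F}$ be a field of characteristic different from $2$. All algebras are vector spaces over $\mathbb{F}$ with a bilinear product $[\cdot,\cdot]$. For an anticommutative algebra put $\mathcal{J}(x,y,z)=[[x,y],z]+[[y,z],x]+[[z,x],y]$. An anticommutative algebra $\mathbf{A}$ is a Malcev algebra if $\mathcal{J}(x,y,[x,z])=[\mathcal{J}(x,y,z),x]$ for all $x,y,z\in\mathbf{A}$, and a binary Lie algebra if $\mathcal{J}([x,y],x,y)=0$ for all $x,y\in\mathbf{A}$. It is nilpotent if $\mathbf{A}^n=0$ for some $n\ge 1$, where $\mathbf{A}^1=\mathbf{A}$ and $\mathbf{A}^{n+1}=\sum_{i=1}^{n}[\mathbf{A}^{i},\mathbf{A}^{n+1-i}]$. On the vector space with basis $e_1,\dots,e_6$ consider the following anticommutative algebras, given by their nonzero products of basis vectors up to anticommutativity (where $\alpha\in\mathbb{F}$, and $\alpha=0$ is allowed): - $\mathbf{B}_{6,1}^{\alpha}$: $[e_1,e_2]=e_4,\ [e_1,e_3]=e_5,\ [e_2,e_3]=\alpha e_6,\ [e_4,e_5]=e_6$; - $\mathbf{B}_{6,2}$: $[e_1,e_2]=e_3,\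 [e_3,e_4]=e_5,\ [e_4,e_5]=e_6$; - $\mathbf{B}_{6,3}$: $[e_1,e_2]=e_3,\ [e_3,e_4]=e_5,\ [e_1,e_3]=e_6,\ [e_4,e_5]=e_6$. These are nilpotent binary Lie algebras that are not Malcev algebras, and every $6$-dimensional nilpotent binary Lie algebra over $\mathbb{F}$ that is not a Malcev algebra is isomorphic to one of them. Among these algebras there are precisely the following isomorphisms: for $\alpha,\beta\in\mathbb{F}$, $\mathbf{B}_{6,1}^{\alpha}\cong\mathbf{B}_{6,1}^{\beta}$ if and only if there is $\lambda\in\mathbb{F}^{*}$ with $\beta=\lambda^2\alpha$; no $\mathbf{B}_{6,1}^{\alpha}$ is isomorphic to $\mathbf{B}_{6,2}$ or to $\mathbf{B}_{6,3}$, and $\mathbf{B}_{6,2}\not\cong\mathbf{B}_{6,3}$. -/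

import Mathlib

universe u v w

namespace BinaryLie

section General

variable {F : Type u} [Field F] {A : Type v} [AddCommGroup A] [Module F A]

/-! An algebra over `F` is an `F`-vector space `A` together with a bilinear multiplication
`μ : A →ₗ[F] A →ₗ[F] A`, where `μ x y` is written `[x, y]` on paper. -/

/-- The multiplication is anticommutative. -/
def IsAnticomm (μ : A →ₗ[F] A →ₗ[F] A) : Prop :=
  ∀ x y : A, μ x y = -μ y x

/-- The Jacobian `[[x, y], z] + [[y, z], x] + [[z, x], y]`. -/
def jacobian (μ : A →ₗ[F] A →ₗ[F] A) (x y z : A) : A :=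
  μ (μ x y) z + μ (μ y z) x + μ (μ z x) y

/-- Malcev algebras: anticommutative algebras with `J(x, y, [x, z]) = [J(x, y, z), x]`. -/
def IsMalcev (μ : A →ₗ[F] A →ₗ[F] A) : Prop :=
  IsAnticomm μ ∧ ∀ x y z : A, jacobian μ x y (μ x z) = μ (jacobian μ x y z) x

/-- Binary Lie algebras: anticommutative algebras with `J([x, y], x, y) = 0`. -/
def IsBinaryLie (μ : A →ₗ[F] A →ₗ[F] A) : Prop :=
  IsAnticomm μ ∧ ∀ x y : A, jacobian μ (μ x y) x y = 0

/-- The powers of an algebra: `power μ 1 = A`, and for `m ≥ 2`, `power μ m` is the sum of the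
subspaces `[power μ i, power μ j]` over `i, j ≥ 1` with `i + j = m`, where `[P, Q]` is the span of
the products. The value at `0` is a convention. -/
def power (μ : A →ₗ[F] A →ₗ[F] A) : ℕ → Submodule F A
  | 0 => ⊤
  | 1 => ⊤
  | n + 2 => ⨆ k : Fin (n + 1), Submodule.map₂ μ (power μ (k + 1)) (power μ (n + 1 - k))

/-- An algebra is nilpotent if one of its powers vanishes. -/
def IsNilpotentAlg (μ : A →ₗ[F] A →ₗ[F] A) : Prop :=
  ∃ n : ℕ, 1 ≤ n ∧ power μ n = ⊥

/-- Nilpotent binary Lie algebras of dimension 6 that are not Malcev algebras. -/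
structure IsNilpotentNonMalcevSix (μ : A →ₗ[F] A →ₗ[F] A) : Prop where
  finrank_eq : Module.finrank F A = 6
  isBinaryLie : IsBinaryLie μ
  isNilpotentAlg : IsNilpotentAlg μ
  not_isMalcev : ¬ IsMalcev μ

/-- Isomorphism of algebras: a linear bijection that preserves the multiplications. -/
def AlgIso {B : Type w} [AddCommGroup B] [Module F B]
    (μ : A →ₗ[F] A →ₗ[F] A) (ν : B →ₗ[F] B →ₗ[F] B) : Prop :=
  ∃ e : A ≃ₗ[F] B, ∀ x y : A, e (μ x y) = ν (e x) (e y)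

end General

section Table

variable (F : Type u) [Field F]

/-- The anticommutative multiplication on `F⁶` whose only nonzero products of vectors of the
standard basis are `[e i, e j] = e k` and `[e j, e i] = - e k` (for `i ≠ j`). -/
def prod (i j k : Fin 6) : (Fin 6 → F) →ₗ[F] (Fin 6 → F) →ₗ[F] (Fin 6 → F) :=
  LinearMap.mk₂ F (fun x y => Pi.single k (x i * y j - x j * y i))
    (fun x x' y => by rw [← Pi.single_add]; congr 1; simp only [Pi.add_apply]; ring)
    (fun c x y => by rw [← Pi.single_smul]; congr 1; simp only [Pi.smul_apply, smul_eq_mul]; ring)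
    (fun x y y' => by rw [← Pi.single_add]; congr 1; simp only [Pi.add_apply]; ring)
    (fun c x y => by rw [← Pi.single_smul]; congr 1; simp only [Pi.smul_apply, smul_eq_mul]; ring)

/-! In the following tables the standard basis vectors are numbered from `0` to `5`, so that the
vector numbered `i` is `e_{i+1}` in the usual numbering `e_1, …, e_6`. -/

/-- `[e₁, e₂] = e₄`, `[e₁, e₃] = e₅`, `[e₂, e₃] = α e₆`, `[e₄, e₅] = e₆`. -/
def B61 (α : F) : (Fin 6 → F) →ₗ[F] (Fin 6 → F) →ₗ[F] (Fin 6 → F) :=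
  prod F 0 1 3 + prod F 0 2 4 + α • prod F 1 2 5 + prod F 3 4 5

/-- `[e₁, e₂] = e₃`, `[e₃, e₄] = e₅`, `[e₄, e₅] = e₆`. -/
def B62 : (Fin 6 → F) →ₗ[F] (Fin 6 → F) →ₗ[F] (Fin 6 → F) :=
  prod F 0 1 2 + prod F 2 3 4 + prod F 3 4 5

/-- `[e₁, e₂] = e₃`, `[e₃, e₄] = e₅`, `[e₁, e₃] = e₆`, `[e₄, e₅] = e₆`. -/
def B63 : (Fin 6 → F) →ₗ[F] (Fin 6 → F) →ₗ[F] (Fin 6 → F) :=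
  prod F 0 1 2 + prod F 2 3 4 + prod F 0 2 5 + prod F 3 4 5

end Table

end BinaryLie

/-! Put L₀ = A and Lₙ₊₁ = [A, Lₙ] (`lcs`). In a nilpotent algebra this chain decreases strictly to
0, and the classification runs over the dimensions of its factors Lₙ/Lₙ₊₁. One criterion recurs: if
L₃ = 0 and the product vanishes on [A, A] = L₁, then A is Malcev (`isMalcev_of_lcs_three_eq_bot`).

An algebra of dimension 6 needs at least two generators. With exactly two, the possible types are
(2,1,3), (2,1,2,1) and (2,1,1,1,1); type (2,1,1,2) is excluded by the binary Lie identities. The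
first type falls under the criterion; in the other two a computation with structure constants shows
that the binary Lie identities force the Jacobi identity. With more generators, the criterion and
strict descent leave only (3,2,1) and (3,1,1,1).

Type (3,2,1): the linear relation between the products of generators modulo L₂ is a bivector in
dimension 3, hence decomposable, so generators x, y, z exist with [y,z] in L₂. Not being Malcev
makes [[x,y],[x,z]] span L₂, and shifting the generators by L₁ produces the table of `B61`
(`algIso_B61_of_finrank`).

Type (3,1,1,1): the product induces an alternating form on A/L₁ with values in the line L₁/L₂; as
the dimension is odd, there is a radical vector z. If [L₁,z] lies in L₃, the algebra is Malcev.
Otherwise, with u = [x,y] and v = [u,z], the identities kill [x,v], [y,v] and [u,v], and a change of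
basis leads to `B62` or `B63` (`algIso_B62_or_B63_of_finrank`).

Vanishing of triple products of the form [[[x,y],z],t] and the centralizer of L₂ separate the three
families; comparing coordinates of an isomorphism gives the square class of α. -/

namespace BinaryLie

/-! ### Lower central series, dimension counts and transport along isomorphisms. -/

section Tools

variable {F : Type u} [Field F] {A : Type v} [AddCommGroup A] [Module F A]
  {μ : A →ₗ[F] A →ₗ[F] A}

/-- The characteristic enters the classification only through this fact. -/
theorem IsAnticomm.self_eq_zero (hF : ringChar F ≠ 2) (h : IsAnticomm μ) (x : A) : μ x x = 0 := by
  have h2 : (2 : F) ≠ 0 := Ring.two_ne_zero hF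
  have h1 : (2 : F) • μ x x = 0 := by
    rw [two_smul]
    nth_rewrite 1 [h x x]
    exact neg_add_cancel _
  exact (smul_eq_zero.mp h1).resolve_left h2

/-- The polarization of `J([x, y], x, y) = 0` in `y`. -/
theorem IsBinaryLie.polarized (h : IsBinaryLie μ) (x y z : A) :
    jacobian μ (μ x y) x z + jacobian μ (μ x z) x y = 0 := by
  have h1 := h.2 x (y + z)
  have h2 := h.2 x y
  have h3 := h.2 x z
  have h4 : jacobian μ (μ x (y + z)) x (y + z) = jacobian μ (μ x y) x y + jacobian μ (μ x z) x z +
      (jacobian μ (μ x y) x z + jacobian μ (μ x z) x y) := by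
    simp only [jacobian, map_add, LinearMap.add_apply]
    abel
  rw [h1, h2, h3] at h4
  simpa using h4.symm

/-- The lower central series, indexed from `0`. -/
def lcs (μ : A →ₗ[F] A →ₗ[F] A) : ℕ → Submodule F A
  | 0 => ⊤
  | n + 1 => Submodule.map₂ μ ⊤ (lcs μ n)

theorem mul_mem_lcs_succ (x : A) {n : ℕ} {y : A} (hy : y ∈ lcs μ n) : μ x y ∈ lcs μ (n + 1) :=
  Submodule.apply_mem_map₂ _ Submodule.mem_top hy

theorem IsAnticomm.mul_mem_lcs_succ (h : IsAnticomm μ) (x : A) {n : ℕ} {y : A}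
    (hy : y ∈ lcs μ n) : μ y x ∈ lcs μ (n + 1) := by
  rw [h y x]
  exact neg_mem (BinaryLie.mul_mem_lcs_succ x hy)

theorem lcs_succ_le_iff {n : ℕ} {N : Submodule F A} :
    lcs μ (n + 1) ≤ N ↔ ∀ x, ∀ y ∈ lcs μ n, μ x y ∈ N := by
  simp [lcs, Submodule.map₂_le]

theorem lcs_succ_le (μ : A →ₗ[F] A →ₗ[F] A) (n : ℕ) : lcs μ (n + 1) ≤ lcs μ n := by
  induction n with
  | zero => exact le_top
  | succ n ih => exact Submodule.map₂_le_map₂ le_rfl ih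

/-- Only this inclusion is needed to use nilpotency. It can be strict: in `B61` the product [e₄,e₅]
= e₆ lies in the fourth power, while `lcs μ 3` is zero. The index shifts by one because `lcs` starts
at 0. -/
theorem lcs_le_power (μ : A →ₗ[F] A →ₗ[F] A) (n : ℕ) : lcs μ n ≤ power μ (n + 1) := by
  induction n with
  | zero => simp [power]
  | succ n ih =>
    rw [power]
    refine le_trans ?_ (le_iSup _ (0 : Fin (n + 1)))
    have h0 : power μ ((0 : Fin (n + 1)) + 1) = ⊤ := by simp [power]
    rw [h0]
    exact Submodule.map₂_le_map₂ le_rfl (by simpa using ih)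

theorem lcs_eq_of_succ_eq {n : ℕ} (h : lcs μ (n + 1) = lcs μ n) (m : ℕ) :
    lcs μ (n + m) = lcs μ n := by
  induction m with
  | zero => rfl
  | succ m ih =>
    have : lcs μ (n + (m + 1)) = Submodule.map₂ μ ⊤ (lcs μ (n + m)) := rfl
    rw [this, ih]
    exact h

/-- A lower central series that stalls once is constant from there on, while nilpotency makes it
reach zero. -/
theorem IsNilpotentAlg.lcs_eq_bot (h : IsNilpotentAlg μ) {n : ℕ}
    (hn : lcs μ (n + 1) = lcs μ n) : lcs μ n = ⊥ := by
  obtain ⟨m, hm, hb⟩ := h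
  obtain ⟨k, rfl⟩ : ∃ k, m = k + 1 := ⟨m - 1, by omega⟩
  have h1 : lcs μ k = ⊥ := le_bot_iff.mp (hb ▸ lcs_le_power μ k)
  have h2 : lcs μ (n + k) ≤ lcs μ k := by
    have : ∀ j, lcs μ (j + k) ≤ lcs μ k := by
      intro j
      induction j with
      | zero => simp
      | succ j ih => exact le_trans (by rw [Nat.succ_add]; exact lcs_succ_le μ _) ih
    exact this n
  rw [← lcs_eq_of_succ_eq hn k]
  exact le_bot_iff.mp (h1 ▸ h2)

theorem IsNilpotentAlg.finrank_lcs_succ_lt [FiniteDimensional F A] (h : IsNilpotentAlg μ) {n : ℕ}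
    (hn : lcs μ n ≠ ⊥) :
    Module.finrank F (lcs μ (n + 1)) < Module.finrank F (lcs μ n) :=
  Submodule.finrank_lt_finrank_of_lt
    (lt_of_le_of_ne (lcs_succ_le μ n) fun he => hn (h.lcs_eq_bot he))

theorem exists_smul_add_of_finrank_le [FiniteDimensional F A] {U V : Submodule F A} (hUV : U ≤ V)
    (hd : Module.finrank F V ≤ Module.finrank F U + 1) {u : A} (hu : u ∈ V) (hu' : u ∉ U) {y : A}
    (hy : y ∈ V) : ∃ c : F, ∃ r ∈ U, y = c • u + r := by
  have h1 : U < U ⊔ Submodule.span F {u} := by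
    refine lt_of_le_of_ne le_sup_left fun h => hu' ?_
    rw [h]
    exact Submodule.mem_sup_right (Submodule.mem_span_singleton_self u)
  have h2 : U ⊔ Submodule.span F {u} ≤ V :=
    sup_le hUV ((Submodule.span_singleton_le_iff_mem _ _).mpr hu)
  have h3 := Submodule.finrank_lt_finrank_of_lt h1
  have h4 := Submodule.eq_of_le_of_finrank_le h2 (by omega)
  rw [← h4] at hy
  obtain ⟨r, hr, t, ht, rfl⟩ := Submodule.mem_sup.mp hy
  obtain ⟨c, rfl⟩ := Submodule.mem_span_singleton.mp ht
  exact ⟨c, r, hr, add_comm _ _⟩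

theorem finrank_le_succ_of_forall [FiniteDimensional F A] {U V : Submodule F A} {u : A}
    (h : ∀ y ∈ V, ∃ c : F, ∃ r ∈ U, y = c • u + r) :
    Module.finrank F V ≤ Module.finrank F U + 1 := by
  have h1 : V ≤ U ⊔ Submodule.span F {u} := by
    intro y hy
    obtain ⟨c, r, hr, rfl⟩ := h y hy
    exact add_mem (Submodule.mem_sup_right (Submodule.smul_mem _ _
      (Submodule.mem_span_singleton_self u))) (Submodule.mem_sup_left hr)
  have h2 := Submodule.finrank_mono h1
  have h3 := Submodule.finrank_add_le_finrank_add_finrank U (Submodule.span F {u})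
  have h4 : Module.finrank F (Submodule.span F {u}) ≤ 1 := by
    simpa using finrank_span_le_card (R := F) ({u} : Set A)
  omega

theorem exists_mem_notMem_of_finrank_lt [FiniteDimensional F A] {U V : Submodule F A}
    (h : Module.finrank F U < Module.finrank F V) : ∃ x ∈ V, x ∉ U := by
  by_contra! hc
  exact absurd (Submodule.finrank_mono (show V ≤ U from hc)) (by omega)

theorem exists_pair_of_finrank_eq [FiniteDimensional F A] {U V : Submodule F A} (hUV : U ≤ V)
    (hd : Module.finrank F V = Module.finrank F U + 2) :
    ∃ x ∈ V, ∃ y ∈ V, ∀ t ∈ V, ∃ a b : F, ∃ r ∈ U, t = a • x + b • y + r := by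
  obtain ⟨x, hx, hxU⟩ := exists_mem_notMem_of_finrank_lt (U := U) (V := V) (by omega)
  have hW : U ⊔ Submodule.span F {x} ≤ V :=
    sup_le hUV ((Submodule.span_singleton_le_iff_mem _ _).mpr hx)
  have hd1 : Module.finrank F ↥(U ⊔ Submodule.span F {x}) ≤ Module.finrank F U + 1 :=
    finrank_le_succ_of_forall (u := x) fun y hy => by
      obtain ⟨r, hr, t, ht, rfl⟩ := Submodule.mem_sup.mp hy
      obtain ⟨c, rfl⟩ := Submodule.mem_span_singleton.mp ht
      exact ⟨c, r, hr, add_comm _ _⟩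
  have hlt : U < U ⊔ Submodule.span F {x} := by
    refine lt_of_le_of_ne le_sup_left fun h => hxU ?_
    rw [h]
    exact Submodule.mem_sup_right (Submodule.mem_span_singleton_self x)
  have hd2 := Submodule.finrank_lt_finrank_of_lt hlt
  obtain ⟨y, hy, hyW⟩ := exists_mem_notMem_of_finrank_lt
    (U := U ⊔ Submodule.span F {x}) (V := V) (by omega)
  refine ⟨x, hx, y, hy, fun t ht => ?_⟩
  obtain ⟨b, s, hs, rfl⟩ := exists_smul_add_of_finrank_le hW (by omega) hy hyW ht
  obtain ⟨r, hr, q, hq, rfl⟩ := Submodule.mem_sup.mp hs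
  obtain ⟨a, rfl⟩ := Submodule.mem_span_singleton.mp hq
  exact ⟨a, b, r, hr, by module⟩

theorem exists_triple_of_finrank_eq [FiniteDimensional F A] {U V : Submodule F A} (hUV : U ≤ V)
    (hd : Module.finrank F V = Module.finrank F U + 3) :
    ∃ x ∈ V, ∃ y ∈ V, ∃ z ∈ V,
      ∀ t ∈ V, ∃ a b c : F, ∃ r ∈ U, t = a • x + b • y + c • z + r := by
  obtain ⟨x, hx, hxU⟩ := exists_mem_notMem_of_finrank_lt (U := U) (V := V) (by omega)
  have hW : U ⊔ Submodule.span F {x} ≤ V :=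
    sup_le hUV ((Submodule.span_singleton_le_iff_mem _ _).mpr hx)
  have hd1 : Module.finrank F ↥(U ⊔ Submodule.span F {x}) ≤ Module.finrank F U + 1 :=
    finrank_le_succ_of_forall (u := x) fun y hy => by
      obtain ⟨r, hr, t, ht, rfl⟩ := Submodule.mem_sup.mp hy
      obtain ⟨c, rfl⟩ := Submodule.mem_span_singleton.mp ht
      exact ⟨c, r, hr, add_comm _ _⟩
  have hlt : U < U ⊔ Submodule.span F {x} := by
    refine lt_of_le_of_ne le_sup_left fun h => hxU ?_
    rw [h]
    exact Submodule.mem_sup_right (Submodule.mem_span_singleton_self x)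
  have hd2 := Submodule.finrank_lt_finrank_of_lt hlt
  obtain ⟨y, hy, z, hz, h⟩ := exists_pair_of_finrank_eq hW (by omega)
  refine ⟨x, hx, y, hy, z, hz, fun t ht => ?_⟩
  obtain ⟨b, c, s, hs, rfl⟩ := h t ht
  obtain ⟨r, hr, q, hq, rfl⟩ := Submodule.mem_sup.mp hs
  obtain ⟨a, rfl⟩ := Submodule.mem_span_singleton.mp hq
  exact ⟨a, b, c, r, hr, by module⟩

/-- A spanning family of the right size that multiplies like the standard basis of `ν`
gives an isomorphism with `ν`. -/
theorem algIso_of_table {n : ℕ} {ν : (Fin n → F) →ₗ[F] (Fin n → F) →ₗ[F] (Fin n → F)}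
    (hμ : IsAnticomm μ) (hμ' : ∀ x, μ x x = 0) (hν : IsAnticomm ν) (hν' : ∀ x, ν x x = 0)
    (hd : Module.finrank F A = n) (e : Fin n → A)
    (hspan : ∀ y : A, ∃ c : Fin n → F, y = ∑ i, c i • e i)
    (htab : ∀ i j, i < j →
      μ (e i) (e j) = ∑ k, ν (Pi.single i 1) (Pi.single j 1) k • e k) : AlgIso μ ν := by
  have htop : ⊤ ≤ Submodule.span F (Set.range e) := by
    intro y _
    obtain ⟨c, rfl⟩ := hspan y
    exact Submodule.sum_mem _ fun i _ => Submodule.smul_mem _ _ (Submodule.subset_span ⟨i, rfl⟩)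
  let b := basisOfTopLeSpanOfCardEqFinrank e htop (by simp [hd])
  have hb : ∀ i, b i = e i := fun i => by simp [b]
  have hbe : ∀ i, b.equivFun (e i) = Pi.single i 1 := fun i => by
    rw [← hb]
    ext k
    simp [Pi.single_apply, eq_comm]
  have hsum : ∀ c : Fin n → F, b.equivFun (∑ k, c k • e k) = c := fun c => by
    have h := b.equivFun_symm_apply c
    simp only [hb] at h
    rw [← h]
    exact b.equivFun.apply_symm_apply c
  have htab' : ∀ i j, b.equivFun (μ (e i) (e j)) = ν (Pi.single i 1) (Pi.single j 1) := by
    intro i j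
    rcases lt_trichotomy i j with h | rfl | h
    · rw [htab i j h, hsum]
    · rw [hμ', hν', map_zero]
    · rw [hμ, hν, htab j i h, map_neg, hsum]
  refine ⟨b.equivFun, fun x y => ?_⟩
  have h1 : μ.compr₂ b.equivFun.toLinearMap =
      ν.compl₁₂ b.equivFun.toLinearMap b.equivFun.toLinearMap := by
    refine b.ext fun i => b.ext fun j => ?_
    simp only [LinearMap.compr₂_apply, LinearMap.compl₁₂_apply, LinearEquiv.coe_coe]
    rw [hb, hb, hbe, hbe]
    exact htab' i j
  exact LinearMap.congr_fun₂ h1 x y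

theorem AlgIso.symm {B : Type w} [AddCommGroup B] [Module F B] {ν : B →ₗ[F] B →ₗ[F] B}
    (h : AlgIso μ ν) : AlgIso ν μ := by
  obtain ⟨e, he⟩ := h
  exact ⟨e.symm, fun x y => e.injective (by simp [he])⟩

theorem AlgIso.isMalcev {B : Type w} [AddCommGroup B] [Module F B] {ν : B →ₗ[F] B →ₗ[F] B}
    (h : AlgIso μ ν) (hν : IsMalcev ν) : IsMalcev μ := by
  obtain ⟨e, he⟩ := h
  refine ⟨fun x y => e.injective ?_, fun x y z => e.injective ?_⟩
  · rw [map_neg, he, he]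
    exact hν.1 _ _
  · simpa only [jacobian, map_add, LinearMap.add_apply, he] using hν.2 (e x) (e y) (e z)

theorem AlgIso.isBinaryLie {B : Type w} [AddCommGroup B] [Module F B] {ν : B →ₗ[F] B →ₗ[F] B}
    (h : AlgIso μ ν) (hν : IsBinaryLie ν) : IsBinaryLie μ := by
  obtain ⟨e, he⟩ := h
  refine ⟨fun x y => e.injective ?_, fun x y => e.injective ?_⟩
  · rw [map_neg, he, he]
    exact hν.1 _ _
  · simpa only [jacobian, map_add, he, map_zero] using hν.2 (e x) (e y)

theorem isMalcev_of_jacobian_eq_zero (h : IsAnticomm μ) (hJ : ∀ x y z, jacobian μ x y z = 0) :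
    IsMalcev μ :=
  ⟨h, fun x y z => by simp [hJ]⟩

end Tools

/-! ### The listed algebras are nilpotent, binary Lie and not Malcev. -/

section Table

variable (F : Type u) [Field F]

theorem prod_apply (i j k : Fin 6) (x y : Fin 6 → F) :
    prod F i j k x y = Pi.single k (x i * y j - x j * y i) := rfl

theorem isAnticomm_prod (i j k : Fin 6) : IsAnticomm (prod F i j k) := by
  intro x y
  rw [prod_apply, prod_apply, ← Pi.single_neg]
  congr 1
  ring

theorem prod_self (i j k : Fin 6) (x : Fin 6 → F) : prod F i j k x x = 0 := by
  rw [prod_apply, mul_comm, sub_self, Pi.single_zero]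

variable {F}

theorem IsAnticomm.add {A : Type v} [AddCommGroup A] [Module F A] {μ ν : A →ₗ[F] A →ₗ[F] A}
    (hμ : IsAnticomm μ) (hν : IsAnticomm ν) : IsAnticomm (μ + ν) := fun x y => by
  rw [LinearMap.add_apply, LinearMap.add_apply, LinearMap.add_apply, LinearMap.add_apply,
    hμ, hν, neg_add]

theorem IsAnticomm.smul {A : Type v} [AddCommGroup A] [Module F A] {μ : A →ₗ[F] A →ₗ[F] A}
    (hμ : IsAnticomm μ) (c : F) : IsAnticomm (c • μ) := fun x y => by
  rw [LinearMap.smul_apply, LinearMap.smul_apply, LinearMap.smul_apply, LinearMap.smul_apply,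
    hμ, smul_neg]

end Table

section Class

variable {F : Type u} [Field F]

theorem isAnticomm_B61 (α : F) : IsAnticomm (B61 F α) :=
  (((isAnticomm_prod F 0 1 3).add (isAnticomm_prod F 0 2 4)).add
    ((isAnticomm_prod F 1 2 5).smul α)).add (isAnticomm_prod F 3 4 5)

theorem isAnticomm_B62 : IsAnticomm (B62 F) :=
  ((isAnticomm_prod F 0 1 2).add (isAnticomm_prod F 2 3 4)).add (isAnticomm_prod F 3 4 5)

theorem isAnticomm_B63 : IsAnticomm (B63 F) :=
  (((isAnticomm_prod F 0 1 2).add (isAnticomm_prod F 2 3 4)).add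
    (isAnticomm_prod F 0 2 5)).add (isAnticomm_prod F 3 4 5)

theorem B61_self (α : F) (x : Fin 6 → F) : B61 F α x x = 0 := by
  simp [B61, prod_self]

theorem B62_self (x : Fin 6 → F) : B62 F x x = 0 := by
  simp [B62, prod_self]

theorem B63_self (x : Fin 6 → F) : B63 F x x = 0 := by
  simp [B63, prod_self]

theorem B61_apply (α : F) (x y : Fin 6 → F) :
    B61 F α x y = ![0, 0, 0, x 0 * y 1 - x 1 * y 0, x 0 * y 2 - x 2 * y 0,
      α * (x 1 * y 2 - x 2 * y 1) + (x 3 * y 4 - x 4 * y 3)] := by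
  ext t
  fin_cases t <;> simp [B61, prod_apply]

theorem B62_apply (x y : Fin 6 → F) :
    B62 F x y = ![0, 0, x 0 * y 1 - x 1 * y 0, 0, x 2 * y 3 - x 3 * y 2,
      x 3 * y 4 - x 4 * y 3] := by
  ext t
  fin_cases t <;> simp [B62, prod_apply]

theorem B63_apply (x y : Fin 6 → F) :
    B63 F x y = ![0, 0, x 0 * y 1 - x 1 * y 0, 0, x 2 * y 3 - x 3 * y 2,
      x 0 * y 2 - x 2 * y 0 + (x 3 * y 4 - x 4 * y 3)] := by
  ext t
  fin_cases t <;> simp [B63, prod_apply]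

theorem isBinaryLie_B61 (α : F) : IsBinaryLie (B61 F α) := by
  refine ⟨isAnticomm_B61 α, fun x y => ?_⟩
  ext t
  fin_cases t <;> simp [jacobian, B61_apply]
  ring

theorem isBinaryLie_B62 : IsBinaryLie (B62 F) := by
  refine ⟨isAnticomm_B62, fun x y => ?_⟩
  ext t
  fin_cases t <;> simp [jacobian, B62_apply]
  all_goals ring

theorem isBinaryLie_B63 : IsBinaryLie (B63 F) := by
  refine ⟨isAnticomm_B63, fun x y => ?_⟩
  ext t
  fin_cases t <;> simp [jacobian, B63_apply]
  all_goals ring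

theorem not_isMalcev_B61 (α : F) : ¬ IsMalcev (B61 F α) := fun h => by
  -- Here J(e₁,e₂,e₃) = 0, whereas J(e₁,e₂,[e₁,e₃]) = [e₄,e₅] = e₆.
  have h1 := congrFun (h.2 (Pi.single 0 1) (Pi.single 1 1) (Pi.single 2 1)) 5
  simp [jacobian, B61_apply] at h1

theorem not_isMalcev_B62 : ¬ IsMalcev (B62 F) := fun h => by
  -- Here [e₄,e₂] = 0, whereas [J(e₄,e₁,e₂),e₄] = [e₅,e₄] = -e₆. The same triple serves for `B63`.
  have h1 := congrFun (h.2 (Pi.single 3 1) (Pi.single 0 1) (Pi.single 1 1)) 5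
  simp [jacobian, B62_apply] at h1

theorem not_isMalcev_B63 : ¬ IsMalcev (B63 F) := fun h => by
  have h1 := congrFun (h.2 (Pi.single 3 1) (Pi.single 0 1) (Pi.single 1 1)) 5
  simp [jacobian, B63_apply] at h1

/-- The span of the standard basis vectors of weight at least `n`. -/
def weightSpace (F : Type u) [Field F] (wt : Fin 6 → ℕ) (n : ℕ) : Submodule F (Fin 6 → F) where
  carrier := {x | ∀ i, wt i < n → x i = 0}
  add_mem' hx hy i hi := by rw [Pi.add_apply, hx i hi, hy i hi, add_zero]
  zero_mem' _ _ := rfl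
  smul_mem' c x hx i hi := by rw [Pi.smul_apply, hx i hi, smul_zero]

theorem prod_mem_weightSpace {wt : Fin 6 → ℕ} {i j k : Fin 6} (h : wt i + wt j ≤ wt k) {a b : ℕ}
    {x y : Fin 6 → F} (hx : x ∈ weightSpace F wt a) (hy : y ∈ weightSpace F wt b) :
    prod F i j k x y ∈ weightSpace F wt (a + b) := by
  intro t ht
  rw [prod_apply]
  rcases eq_or_ne t k with rfl | hne
  · have h1 : x i * y j = 0 := by
      rcases lt_or_ge (wt i) a with h' | h'
      · rw [hx i h', zero_mul]
      · rw [hy j (by omega), mul_zero]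
    have h2 : x j * y i = 0 := by
      rcases lt_or_ge (wt j) a with h' | h'
      · rw [hx j h', zero_mul]
      · rw [hy i (by omega), mul_zero]
    rw [h1, h2, sub_zero, Pi.single_zero, Pi.zero_apply]
  · rw [Pi.single_apply, if_neg hne]

/-- The weights define a multiplicative filtration, so the powers descend at least as fast as the
weights. -/
theorem power_le_weightSpace {μ : (Fin 6 → F) →ₗ[F] (Fin 6 → F) →ₗ[F] (Fin 6 → F)}
    {wt : Fin 6 → ℕ} (hpos : ∀ i, 1 ≤ wt i)
    (hμ : ∀ a b x y, x ∈ weightSpace F wt a → y ∈ weightSpace F wt b →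
      μ x y ∈ weightSpace F wt (a + b)) (n : ℕ) :
    power μ n ≤ weightSpace F wt n := by
  induction n using Nat.strong_induction_on with
  | _ n ih =>
    match n with
    | 0 => exact fun x _ i hi => absurd hi (Nat.not_lt_zero _)
    | 1 => exact fun x _ i hi => absurd (hpos i) (by omega)
    | n + 2 =>
      rw [power]
      refine iSup_le fun k => Submodule.map₂_le.mpr fun x hx y hy => ?_
      have hk := k.2
      have h1 := hμ _ _ x y (ih (k + 1) (by omega) hx) (ih (n + 1 - k) (by omega) hy)
      rwa [show (k : ℕ) + 1 + (n + 1 - k) = n + 2 by omega] at h1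

theorem weightSpace_eq_bot {wt : Fin 6 → ℕ} {n : ℕ} (h : ∀ i, wt i < n) :
    weightSpace F wt n = ⊥ :=
  le_bot_iff.mp fun _ hx => (Submodule.mem_bot F).mpr (funext fun i => hx i (h i))

theorem isNilpotentAlg_of_weight {μ : (Fin 6 → F) →ₗ[F] (Fin 6 → F) →ₗ[F] (Fin 6 → F)}
    {wt : Fin 6 → ℕ} (hpos : ∀ i, 1 ≤ wt i) {n : ℕ} (hn : ∀ i, wt i < n)
    (hμ : ∀ a b x y, x ∈ weightSpace F wt a → y ∈ weightSpace F wt b →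
      μ x y ∈ weightSpace F wt (a + b)) : IsNilpotentAlg μ :=
  ⟨n, (hpos 0).trans (hn 0).le, le_bot_iff.mp
    (weightSpace_eq_bot (F := F) hn ▸ power_le_weightSpace hpos hμ n)⟩

theorem isNilpotentAlg_B61 (α : F) : IsNilpotentAlg (B61 F α) :=
  -- A product may exceed the sum of the weights of its factors: [e₂,e₃] = αe₆ has weight 4 instead
  -- of 2, so one weight vector serves every α.
  isNilpotentAlg_of_weight (wt := ![1, 1, 1, 2, 2, 4]) (n := 5) (by decide) (by decide)
    fun _ _ _ _ hx hy => add_mem (add_mem (add_mem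
      (prod_mem_weightSpace (by decide) hx hy) (prod_mem_weightSpace (by decide) hx hy))
      (Submodule.smul_mem _ _ (prod_mem_weightSpace (by decide) hx hy)))
      (prod_mem_weightSpace (by decide) hx hy)

theorem isNilpotentAlg_B62 : IsNilpotentAlg (B62 F) :=
  isNilpotentAlg_of_weight (wt := ![1, 1, 2, 1, 3, 4]) (n := 5) (by decide) (by decide)
    fun _ _ _ _ hx hy => add_mem (add_mem
      (prod_mem_weightSpace (by decide) hx hy) (prod_mem_weightSpace (by decide) hx hy))
      (prod_mem_weightSpace (by decide) hx hy)

theorem isNilpotentAlg_B63 : IsNilpotentAlg (B63 F) :=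
  isNilpotentAlg_of_weight (wt := ![1, 1, 2, 1, 3, 4]) (n := 5) (by decide) (by decide)
    fun _ _ _ _ hx hy => add_mem (add_mem (add_mem
      (prod_mem_weightSpace (by decide) hx hy) (prod_mem_weightSpace (by decide) hx hy))
      (prod_mem_weightSpace (by decide) hx hy)) (prod_mem_weightSpace (by decide) hx hy)

theorem isNilpotentNonMalcevSix_B61 (α : F) : IsNilpotentNonMalcevSix (B61 F α) :=
  ⟨by simp, isBinaryLie_B61 α, isNilpotentAlg_B61 α, not_isMalcev_B61 α⟩

theorem isNilpotentNonMalcevSix_B62 : IsNilpotentNonMalcevSix (B62 F) :=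
  ⟨by simp, isBinaryLie_B62, isNilpotentAlg_B62, not_isMalcev_B62⟩

theorem isNilpotentNonMalcevSix_B63 : IsNilpotentNonMalcevSix (B63 F) :=
  ⟨by simp, isBinaryLie_B63, isNilpotentAlg_B63, not_isMalcev_B63⟩

end Class

/-! ### Isomorphisms among the listed algebras. -/

section Isomorphism

variable {F : Type u} [Field F]

theorem B61_mul_mul_mul (α : F) (x y z t : Fin 6 → F) :
    B61 F α (B61 F α (B61 F α x y) z) t = 0 := by
  ext i
  fin_cases i <;> simp [B61_apply]

theorem not_algIso_B61_of_mul_ne_zero {α : F}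
    {ν : (Fin 6 → F) →ₗ[F] (Fin 6 → F) →ₗ[F] (Fin 6 → F)}
    {x y z t : Fin 6 → F} (h : ν (ν (ν x y) z) t ≠ 0) : ¬ AlgIso (B61 F α) ν := by
  intro hiso
  obtain ⟨e, he⟩ := hiso.symm
  refine h (e.injective ?_)
  rw [he, he, he, B61_mul_mul_mul, map_zero]

theorem not_algIso_B61_B62 (α : F) : ¬ AlgIso (B61 F α) (B62 F) := by
  refine not_algIso_B61_of_mul_ne_zero (x := Pi.single 0 1) (y := Pi.single 1 1)
    (z := Pi.single 3 1) (t := Pi.single 3 1) fun h => ?_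
  have h1 := congrFun h 5
  simp [B62_apply] at h1

theorem not_algIso_B61_B63 (α : F) : ¬ AlgIso (B61 F α) (B63 F) := by
  refine not_algIso_B61_of_mul_ne_zero (x := Pi.single 0 1) (y := Pi.single 1 1)
    (z := Pi.single 3 1) (t := Pi.single 3 1) fun h => ?_
  have h1 := congrFun h 5
  simp [B63_apply] at h1

theorem not_algIso_B62_B63 : ¬ AlgIso (B62 F) (B63 F) := by
  intro hiso
  obtain ⟨e, he⟩ := hiso.symm
  -- In `B62` an element that centralizes all products [[p,q],r] has no e₄-component. In `B63` both
  -- e₁ and e₂ centralize them, so their images in `B62` lie in the hyperplane without e₄, where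
  -- every [[x,y],x] vanishes; but [[e₁,e₂],e₁] = -e₆ in `B63`.
  have key : ∀ x : Fin 6 → F, (∀ p q r, B63 F x (B63 F (B63 F p q) r) = 0) → e x 3 = 0 := by
    intro x hx
    have h1 := congrArg e (hx (e.symm (Pi.single 0 1)) (e.symm (Pi.single 1 1))
      (e.symm (Pi.single 3 1)))
    simp only [he, LinearEquiv.apply_symm_apply, map_zero] at h1
    have h2 := congrFun h1 5
    simpa [B62_apply] using h2
  have h0 := key (Pi.single 0 1) fun p q r => by
    ext i
    fin_cases i <;> simp [B63_apply]
  have h1 := key (Pi.single 1 1) fun p q r => by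
    ext i
    fin_cases i <;> simp [B63_apply]
  have h2 : B63 F (B63 F (Pi.single 0 1) (Pi.single 1 1)) (Pi.single 0 1) = 0 := by
    refine e.injective ?_
    rw [he, he, map_zero]
    ext i
    fin_cases i <;> simp [B62_apply, h0, h1]
  have h3 := congrFun h2 5
  simp [B63_apply] at h3

theorem algIso_B61_of_table {A : Type v} [AddCommGroup A] [Module F A] {μ : A →ₗ[F] A →ₗ[F] A}
    (hμ : IsAnticomm μ) (hμ' : ∀ x, μ x x = 0) (hd : Module.finrank F A = 6) (α : F)
    (e₁ e₂ e₃ e₄ e₅ e₆ : A)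
    (hspan : ∀ y : A, ∃ c : Fin 6 → F, y = c 0 • e₁ + c 1 • e₂ + c 2 • e₃ + c 3 • e₄ + c 4 • e₅ +
      c 5 • e₆)
    (h12 : μ e₁ e₂ = e₄) (h13 : μ e₁ e₃ = e₅) (h14 : μ e₁ e₄ = 0) (h15 : μ e₁ e₅ = 0)
    (h16 : μ e₁ e₆ = 0) (h23 : μ e₂ e₃ = α • e₆) (h24 : μ e₂ e₄ = 0) (h25 : μ e₂ e₅ = 0)
    (h26 : μ e₂ e₆ = 0) (h34 : μ e₃ e₄ = 0) (h35 : μ e₃ e₅ = 0) (h36 : μ e₃ e₆ = 0)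
    (h45 : μ e₄ e₅ = e₆) (h46 : μ e₄ e₆ = 0) (h56 : μ e₅ e₆ = 0) : AlgIso μ (B61 F α) := by
  refine algIso_of_table hμ hμ' (isAnticomm_B61 α) (B61_self α) hd ![e₁, e₂, e₃, e₄, e₅, e₆] ?_ ?_
  · intro y
    obtain ⟨c, hc⟩ := hspan y
    exact ⟨c, by simpa [Fin.sum_univ_six] using hc⟩
  · intro i j hij
    fin_cases i <;> fin_cases j <;>
      first
      | exact absurd hij (by decide)
      | simp [Fin.sum_univ_six, B61_apply, *]

theorem algIso_B61_iff (α β : F) :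
    AlgIso (B61 F α) (B61 F β) ↔ ∃ c : F, c ≠ 0 ∧ β = c ^ 2 * α := by
  constructor
  · rintro ⟨e, he⟩
    obtain ⟨f, hf⟩ : ∃ f : Fin 6 → Fin 6 → F, ∀ i, f i = e (Pi.single i 1) := ⟨_, fun _ => rfl⟩
    have htab : ∀ i j, B61 F β (f i) (f j) = e (B61 F α (Pi.single i 1) (Pi.single j 1)) := by
      intro i j
      rw [he, hf, hf]
    have h12 : B61 F β (f 0) (f 1) = f 3 := by
      rw [htab, hf]
      congr 1
      ext t
      fin_cases t <;> simp [B61_apply]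
    have h13 : B61 F β (f 0) (f 2) = f 4 := by
      rw [htab, hf]
      congr 1
      ext t
      fin_cases t <;> simp [B61_apply]
    have h23 : B61 F β (f 1) (f 2) = α • f 5 := by
      rw [htab, hf, ← map_smul]
      congr 1
      ext t
      fin_cases t <;> simp [B61_apply]
    have h24 : B61 F β (f 1) (f 3) = 0 := by
      rw [htab, ← map_zero e]
      congr 1
      ext t
      fin_cases t <;> simp [B61_apply]
    have h25 : B61 F β (f 1) (f 4) = 0 := by
      rw [htab, ← map_zero e]
      congr 1
      ext t
      fin_cases t <;> simp [B61_apply]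
    have h45 : B61 F β (f 3) (f 4) = f 5 := by
      rw [htab, hf]
      congr 1
      ext t
      fin_cases t <;> simp [B61_apply]
    have h6 : f 5 ≠ 0 := by
      rw [hf]
      exact e.map_ne_zero_iff.mpr (by simp)
    simp only [B61_apply, funext_iff, Fin.forall_fin_succ] at h12 h13 h23 h24 h25 h45
    simp at h12 h13 h23 h24 h25 h45
    obtain ⟨a0, a1, a2, a3, a4, -⟩ := h12
    obtain ⟨b0, b1, b2, b3, b4, -⟩ := h13
    obtain ⟨d0, d1, d2, d3, d4, d5⟩ := h45
    rw [← a0, ← b0, ← a1, ← b1] at d3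
    rw [← a0, ← b0, ← a2, ← b2] at d4
    rw [← a1, ← b1, ← a2, ← b2] at d5
    obtain ⟨-, -, h24⟩ := h24
    obtain ⟨-, -, h25⟩ := h25
    rw [← a1, ← a2] at h24
    rw [← b1, ← b2] at h25
    obtain ⟨-, -, -, m1, m2, m3⟩ := h23
    rw [← d3] at m1
    rw [← d4] at m2
    -- Only the last coordinate of `f 5`, the product of `f 3` and `f 4`, can be nonzero, and it
    -- equals this minor.
    have hD : f 3 3 * f 4 4 - f 3 4 * f 4 3 ≠ 0 := by
      intro h
      rw [h] at d5
      refine h6 (funext fun t => ?_)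
      fin_cases t
      · exact d0.symm
      · exact d1.symm
      · exact d2.symm
      · simpa using d3.symm
      · simpa using d4.symm
      · simpa using d5.symm
    have e1 : f 1 0 * f 4 3 - f 2 0 * f 3 3 = 0 := by
      rw [← a3, ← b3]
      linear_combination f 0 0 * m1
    have e2 : f 1 0 * f 4 4 - f 2 0 * f 3 4 = 0 := by
      rw [← a4, ← b4]
      linear_combination f 0 0 * m2
    -- Each of the four vanishings solves a homogeneous 2 × 2 system whose determinant is, up to
    -- sign, the nonzero minor.
    have hq : f 1 0 = 0 := (mul_eq_zero.mp (show f 1 0 * (f 3 3 * f 4 4 - f 3 4 * f 4 3) = 0 by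
      linear_combination f 3 3 * e2 - f 3 4 * e1)).resolve_right hD
    have hr : f 2 0 = 0 := (mul_eq_zero.mp (show f 2 0 * (f 3 3 * f 4 4 - f 3 4 * f 4 3) = 0 by
      linear_combination f 4 3 * e2 - f 4 4 * e1)).resolve_right hD
    have hq3 : f 1 3 = 0 := (mul_eq_zero.mp (show f 1 3 * (f 3 3 * f 4 4 - f 3 4 * f 4 3) = 0 by
      linear_combination f 3 3 * h25 - f 4 3 * h24)).resolve_right hD
    have hq4 : f 1 4 = 0 := (mul_eq_zero.mp (show f 1 4 * (f 3 3 * f 4 4 - f 3 4 * f 4 3) = 0 by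
      linear_combination f 3 4 * h25 - f 4 4 * h24)).resolve_right hD
    rw [← d5, hq3, hq4, ← a3, ← a4, ← b3, ← b4, hq, hr] at m3
    rw [← a3, ← a4, ← b3, ← b4, hq, hr] at hD
    have hδ : f 1 1 * f 2 2 - f 1 2 * f 2 1 ≠ 0 := fun h =>
      hD (by linear_combination f 0 0 ^ 2 * h)
    -- The scalar is the e₁-coordinate of the image of e₁. With δ the minor of `hδ`, the last
    -- coordinate of [f 1, f 2] = α • f 5 now reads βδ = α (f 0 0)² δ.
    refine ⟨f 0 0, fun h => hD (by rw [h]; ring), mul_right_cancel₀ hδ ?_⟩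
    linear_combination m3
  · rintro ⟨c, hc, rfl⟩
    refine AlgIso.symm ?_
    refine algIso_B61_of_table (isAnticomm_B61 _) (B61_self _) (by simp) _ (Pi.single 0 c)
      (Pi.single 1 1) (Pi.single 2 1) (Pi.single 3 c) (Pi.single 4 c) (Pi.single 5 (c ^ 2))
      ?_ ?_ ?_ ?_ ?_ ?_ ?_ ?_ ?_ ?_ ?_ ?_ ?_ ?_ ?_ ?_
    · intro y
      refine ⟨![y 0 / c, y 1, y 2, y 3 / c, y 4 / c, y 5 / c ^ 2], ?_⟩
      ext t
      fin_cases t <;> simp [hc]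
    all_goals
      ext t
      fin_cases t <;> simp [B61_apply]
    all_goals ring

end Isomorphism

/-! ### Type (3,2,1): reduction to `B61`. -/

section CentralThree

variable {F : Type u} [Field F] {A : Type v} [AddCommGroup A] [Module F A]
  {μ : A →ₗ[F] A →ₗ[F] A}

theorem mul_eq_zero_of_lcs_eq_bot {n : ℕ} (hn : lcs μ (n + 1) = ⊥) (x : A) {y : A}
    (hy : y ∈ lcs μ n) : μ x y = 0 :=
  (Submodule.mem_bot F).mp (hn ▸ mul_mem_lcs_succ x hy)

theorem IsAnticomm.mul_eq_zero_of_lcs_eq_bot (h : IsAnticomm μ) {n : ℕ} (hn : lcs μ (n + 1) = ⊥)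
    (x : A) {y : A} (hy : y ∈ lcs μ n) : μ y x = 0 := by
  rw [h, BinaryLie.mul_eq_zero_of_lcs_eq_bot hn x hy, neg_zero]

theorem mul_mem_lcs_one (μ : A →ₗ[F] A →ₗ[F] A) (x y : A) : μ x y ∈ lcs μ 1 :=
  mul_mem_lcs_succ x Submodule.mem_top

/-- Every term of the Malcev identity is a product [[[a,b],c],d] up to sign, hence zero, except
[[x,y],[x,z]], which `hC` kills. -/
theorem isMalcev_of_lcs_three_eq_bot (h : IsAnticomm μ) (h3 : lcs μ 3 = ⊥)
    (hC : ∀ x ∈ lcs μ 1, ∀ y ∈ lcs μ 1, μ x y = 0) : IsMalcev μ := by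
  refine ⟨h, fun x y z => ?_⟩
  have hz : ∀ a b c d, μ (μ (μ a b) c) d = 0 := fun a b c d =>
    h.mul_eq_zero_of_lcs_eq_bot h3 d (h.mul_mem_lcs_succ c (mul_mem_lcs_one μ a b))
  simp only [jacobian, map_add, LinearMap.add_apply, hz]
  rw [hC _ (mul_mem_lcs_one μ x y) _ (mul_mem_lcs_one μ x z), h y, map_neg, LinearMap.neg_apply, hz]
  simp

/-- Products of a family that spans modulo `[A, A]` span `[A, A]` modulo `[A, [A, A]]`. -/
theorem exists_of_mem_lcs_one (h : IsAnticomm μ) (h0 : ∀ x, μ x x = 0) {x y z : A}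
    (hs : ∀ t, ∃ a b c : F, ∃ r ∈ lcs μ 1, t = a • x + b • y + c • z + r) {t : A}
    (ht : t ∈ lcs μ 1) :
    ∃ a b c : F, ∃ r ∈ lcs μ 2, t = a • μ x y + b • μ x z + c • μ y z + r := by
  have hle : lcs μ 1 ≤ Submodule.span F {μ x y, μ x z, μ y z} ⊔ lcs μ 2 := by
    refine lcs_succ_le_iff.mpr fun p q _ => ?_
    obtain ⟨a, b, c, r, hr, rfl⟩ := hs p
    obtain ⟨a', b', c', r', hr', rfl⟩ := hs q
    refine Submodule.mem_sup.mpr ⟨(a * b' - b * a') • μ x y + (a * c' - c * a') • μ x z +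
      (b * c' - c * b') • μ y z, Submodule.mem_span_triple.mpr ⟨_, _, _, rfl⟩,
      μ (a • x + b • y + c • z) r' + μ r (a' • x + b' • y + c' • z + r'),
      add_mem (mul_mem_lcs_succ _ hr') (h.mul_mem_lcs_succ _ hr), ?_⟩
    simp only [map_add, map_smul, LinearMap.add_apply, LinearMap.smul_apply, h0, h y x, h z x,
      h z y]
    module
  obtain ⟨p, hp, r, hr, rfl⟩ := Submodule.mem_sup.mp (hle ht)
  obtain ⟨a, b, c, rfl⟩ := Submodule.mem_span_triple.mp hp
  exact ⟨a, b, c, r, hr, rfl⟩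

variable [FiniteDimensional F A]

theorem exists_smul_of_finrank_le_one {V : Submodule F A} (hd : Module.finrank F V ≤ 1) {u : A}
    (hu : u ∈ V) (hu' : u ≠ 0) {y : A} (hy : y ∈ V) : ∃ c : F, y = c • u := by
  obtain ⟨c, r, hr, h⟩ := exists_smul_add_of_finrank_le (U := ⊥) bot_le (by simpa using hd) hu
    (by simpa using hu') hy
  rw [Submodule.mem_bot] at hr
  exact ⟨c, by rw [h, hr, add_zero]⟩

theorem algIso_B61_of_mul_eq_zero (h : IsAnticomm μ) (h0 : ∀ x, μ x x = 0)
    (hM : ¬ IsMalcev μ) (hd : Module.finrank F A = 6) (h2 : Module.finrank F (lcs μ 2) = 1)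
    (h3 : lcs μ 3 = ⊥) {x y z : A}
    (hs : ∀ t, ∃ a b c : F, ∃ r ∈ lcs μ 1, t = a • x + b • y + c • z + r)
    (hyz : μ y z ∈ lcs μ 2) (hx1 : μ x (μ x y) = 0) (hx2 : μ x (μ x z) = 0)
    (hy1 : μ y (μ x y) = 0) (hy2 : μ y (μ x z) = 0) (hz1 : μ z (μ x y) = 0)
    (hz2 : μ z (μ x z) = 0) : ∃ α : F, AlgIso μ (B61 F α) := by
  have hs1 : ∀ t ∈ lcs μ 1, ∃ a b : F, ∃ r ∈ lcs μ 2, t = a • μ x y + b • μ x z + r := by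
    intro t ht
    obtain ⟨a, b, c, r, hr, rfl⟩ := exists_of_mem_lcs_one h h0 hs ht
    exact ⟨a, b, _, add_mem (Submodule.smul_mem _ c hyz) hr, by module⟩
  have hne : μ (μ x y) (μ x z) ≠ 0 := by
    intro he
    refine hM (isMalcev_of_lcs_three_eq_bot h h3 fun p hp q hq => ?_)
    obtain ⟨a, b, r, hr, rfl⟩ := hs1 p hp
    obtain ⟨a', b', r', hr', rfl⟩ := hs1 q hq
    simp [h0, he, h (μ x z) (μ x y), mul_eq_zero_of_lcs_eq_bot h3 _ hr',
      h.mul_eq_zero_of_lcs_eq_bot h3 _ hr]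
  have hmem : μ (μ x y) (μ x z) ∈ lcs μ 2 := mul_mem_lcs_succ _ (mul_mem_lcs_one μ _ _)
  have hs2 : ∀ t ∈ lcs μ 2, ∃ c : F, t = c • μ (μ x y) (μ x z) := fun t ht =>
    exists_smul_of_finrank_le_one h2.le hmem hne ht
  obtain ⟨α, hα⟩ := hs2 _ hyz
  have hc : ∀ t, μ t (μ (μ x y) (μ x z)) = 0 := fun t => mul_eq_zero_of_lcs_eq_bot h3 t hmem
  refine ⟨α, algIso_B61_of_table h h0 hd α x y z (μ x y) (μ x z) (μ (μ x y) (μ x z)) ?_ rfl rfl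
    hx1 hx2 (hc _) hα hy1 hy2 (hc _) hz1 hz2 (hc _) rfl (hc _) (hc _)⟩
  intro t
  obtain ⟨a, b, c, r, hr, rfl⟩ := hs t
  obtain ⟨a', b', r', hr', rfl⟩ := hs1 r hr
  obtain ⟨c', rfl⟩ := hs2 r' hr'
  exact ⟨![a, b, c, a', b', c'], by simp; abel⟩

/-- Multiplication on `lcs μ 1` modulo `lcs μ 2` is a nondegenerate alternating form on a plane.
Hence the action of each generator on that plane can be cancelled by adding an element of `lcs μ 1`;
this changes products of generators only by central elements. -/
theorem algIso_B61_of_mul_mem (h : IsAnticomm μ) (h0 : ∀ x, μ x x = 0)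
    (hM : ¬ IsMalcev μ) (hd : Module.finrank F A = 6) (h2 : Module.finrank F (lcs μ 2) = 1)
    (h3 : lcs μ 3 = ⊥) {x y z : A}
    (hs : ∀ t, ∃ a b c : F, ∃ r ∈ lcs μ 1, t = a • x + b • y + c • z + r)
    (hyz : μ y z ∈ lcs μ 2) : ∃ α : F, AlgIso μ (B61 F α) := by
  have hs1 : ∀ t ∈ lcs μ 1, ∃ a b : F, ∃ r ∈ lcs μ 2, t = a • μ x y + b • μ x z + r := by
    intro t ht
    obtain ⟨a, b, c, r, hr, rfl⟩ := exists_of_mem_lcs_one h h0 hs ht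
    exact ⟨a, b, _, add_mem (Submodule.smul_mem _ c hyz) hr, by module⟩
  have hne : μ (μ x y) (μ x z) ≠ 0 := by
    intro he
    refine hM (isMalcev_of_lcs_three_eq_bot h h3 fun p hp q hq => ?_)
    obtain ⟨a, b, r, hr, rfl⟩ := hs1 p hp
    obtain ⟨a', b', r', hr', rfl⟩ := hs1 q hq
    simp [h0, he, h (μ x z) (μ x y), mul_eq_zero_of_lcs_eq_bot h3 _ hr',
      h.mul_eq_zero_of_lcs_eq_bot h3 _ hr]
  have hmem : μ (μ x y) (μ x z) ∈ lcs μ 2 := mul_mem_lcs_succ _ (mul_mem_lcs_one μ _ _)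
  have hs2 : ∀ t ∈ lcs μ 2, ∃ c : F, t = c • μ (μ x y) (μ x z) := fun t ht =>
    exists_smul_of_finrank_le_one h2.le hmem hne ht
  have hshift : ∀ t, ∃ l ∈ lcs μ 1, μ (t + l) (μ x y) = 0 ∧ μ (t + l) (μ x z) = 0 := by
    intro t
    obtain ⟨a, ha⟩ := hs2 _ (mul_mem_lcs_succ t (mul_mem_lcs_one μ x y))
    obtain ⟨b, hb⟩ := hs2 _ (mul_mem_lcs_succ t (mul_mem_lcs_one μ x z))
    -- The products of μ x z and μ x y with μ x y and μ x z are -w and w, for w = μ (μ x y) (μ x z),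
    -- which fixes both coefficients.
    refine ⟨a • μ x z - b • μ x y, sub_mem (Submodule.smul_mem _ _ (mul_mem_lcs_one μ _ _))
      (Submodule.smul_mem _ _ (mul_mem_lcs_one μ _ _)), ?_, ?_⟩
    · simp [h0, ha, h (μ x z) (μ x y)]
    · simp [h0, hb]
  obtain ⟨lx, hlx, hx1, hx2⟩ := hshift x
  obtain ⟨ly, hly, hy1, hy2⟩ := hshift y
  obtain ⟨lz, hlz, hz1, hz2⟩ := hshift z
  have hmul : ∀ s t l m, l ∈ lcs μ 1 → m ∈ lcs μ 1 → ∃ r ∈ lcs μ 2,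
      μ (s + l) (t + m) = μ s t + r := by
    intro s t l m hl hm
    refine ⟨_, add_mem (mul_mem_lcs_succ (s + l) hm) (h.mul_mem_lcs_succ t hl), ?_⟩
    simp only [map_add, LinearMap.add_apply]
    abel
  have hadd : ∀ t s r, r ∈ lcs μ 2 → μ t (s + r) = μ t s := fun t s r hr => by
    rw [map_add, mul_eq_zero_of_lcs_eq_bot h3 t hr, add_zero]
  obtain ⟨r1, hr1, he1⟩ := hmul x y lx ly hlx hly
  obtain ⟨r2, hr2, he2⟩ := hmul x z lx lz hlx hlz
  obtain ⟨r3, hr3, he3⟩ := hmul y z ly lz hly hlz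
  refine algIso_B61_of_mul_eq_zero h h0 hM hd h2 h3 (x := x + lx) (y := y + ly) (z := z + lz)
    ?_ ?_ ?_ ?_ ?_ ?_ ?_ ?_
  · intro t
    obtain ⟨a, b, c, r, hr, rfl⟩ := hs t
    exact ⟨a, b, c, r - a • lx - b • ly - c • lz,
      sub_mem (sub_mem (sub_mem hr (Submodule.smul_mem _ _ hlx)) (Submodule.smul_mem _ _ hly))
        (Submodule.smul_mem _ _ hlz), by module⟩
  · rw [he3]
    exact add_mem hyz hr3
  all_goals
    first
    | rw [he1, hadd _ _ _ hr1]; assumption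
    | rw [he2, hadd _ _ _ hr2]; assumption

/-- The bivector p x∧y + q x∧z + r y∧z factors as r (y + (q/r)x) ∧ (z - (p/r)x), and its factors
serve as new generators. -/
theorem algIso_B61_of_smul_add_mem (h : IsAnticomm μ) (h0 : ∀ x, μ x x = 0)
    (hM : ¬ IsMalcev μ) (hd : Module.finrank F A = 6) (h2 : Module.finrank F (lcs μ 2) = 1)
    (h3 : lcs μ 3 = ⊥) {x y z : A}
    (hs : ∀ t, ∃ a b c : F, ∃ r ∈ lcs μ 1, t = a • x + b • y + c • z + r) {p q r : F}
    (hr : r ≠ 0) (hmem : p • μ x y + q • μ x z + r • μ y z ∈ lcs μ 2) :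
    ∃ α : F, AlgIso μ (B61 F α) := by
  refine algIso_B61_of_mul_mem h h0 hM hd h2 h3 (x := x) (y := y + (q / r) • x)
    (z := z - (p / r) • x) ?_ ?_
  · intro t
    obtain ⟨a, b, c, s, hs, rfl⟩ := hs t
    exact ⟨a - b * (q / r) + c * (p / r), b, c, s, hs, by module⟩
  · have h1 := Submodule.smul_mem _ r⁻¹ hmem
    convert h1 using 1
    simp only [map_add, map_sub, map_smul, LinearMap.add_apply, LinearMap.smul_apply, h0, h y x,
      smul_add, smul_smul, inv_mul_cancel₀ hr, one_smul]
    module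

theorem algIso_B61_of_finrank (h : IsAnticomm μ) (h0 : ∀ x, μ x x = 0)
    (hM : ¬ IsMalcev μ) (hd : Module.finrank F A = 6) (h1 : Module.finrank F (lcs μ 1) = 3)
    (h2 : Module.finrank F (lcs μ 2) = 1) (h3 : lcs μ 3 = ⊥) :
    ∃ α : F, AlgIso μ (B61 F α) := by
  obtain ⟨x, -, y, -, z, -, hs⟩ := exists_triple_of_finrank_eq (U := lcs μ 1)
    (V := (⊤ : Submodule F A)) le_top (by rw [finrank_top, hd, h1])
  replace hs := fun t => hs t Submodule.mem_top
  have hrel : ∃ p q r : F, (p, q, r) ≠ 0 ∧ p • μ x y + q • μ x z + r • μ y z ∈ lcs μ 2 := by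
    obtain ⟨s, -, t, -, hst⟩ := exists_pair_of_finrank_eq (lcs_succ_le μ 1) (by rw [h1, h2])
    obtain ⟨a, b, k, hk, ha⟩ := hst _ (mul_mem_lcs_one μ x y)
    obtain ⟨c, d, l, hl, hc⟩ := hst _ (mul_mem_lcs_one μ x z)
    obtain ⟨f, g, m, hm, hf⟩ := hst _ (mul_mem_lcs_one μ y z)
    -- The columns are the coordinates of the three products in the plane `lcs μ 1` modulo `lcs μ
    -- 2`; a 2 × 3 matrix has a nontrivial kernel.
    obtain ⟨v, hv, hv0⟩ := Submodule.exists_mem_ne_zero_of_ne_bot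
      (LinearMap.ker_ne_bot_of_finrank_lt (f := Matrix.mulVecLin !![a, c, f; b, d, g]) (by simp))
    have e0 := congrFun (LinearMap.mem_ker.mp hv) 0
    have e1 := congrFun (LinearMap.mem_ker.mp hv) 1
    simp only [Matrix.mulVecLin_apply, Matrix.mulVec, dotProduct, Fin.sum_univ_three] at e0 e1
    simp at e0 e1
    refine ⟨v 0, v 1, v 2, fun he => hv0 ?_, ?_⟩
    · simp only [Prod.mk_eq_zero] at he
      ext i
      fin_cases i
      exacts [he.1, he.2.1, he.2.2]
    · have hmem : v 0 • k + v 1 • l + v 2 • m ∈ lcs μ 2 := add_mem (add_mem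
        (Submodule.smul_mem _ _ hk) (Submodule.smul_mem _ _ hl)) (Submodule.smul_mem _ _ hm)
      convert hmem using 1
      rw [ha, hc, hf]
      linear_combination (norm := module) e0 • s + e1 • t
  obtain ⟨p, q, r, hne, hmem⟩ := hrel
  by_cases hr : r = 0
  · by_cases hq : q = 0
    · have hp : p ≠ 0 := fun hp => hne (by rw [hp, hq, hr]; rfl)
      refine algIso_B61_of_smul_add_mem h h0 hM hd h2 h3 (x := z) (y := x) (z := y)
        (p := -q) (q := -r) (r := p) ?_ hp ?_
      · intro t
        obtain ⟨a, b, c, s, hs, rfl⟩ := hs t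
        exact ⟨c, a, b, s, hs, by abel⟩
      · rw [h z x, h z y]
        convert hmem using 1
        module
    · refine algIso_B61_of_smul_add_mem h h0 hM hd h2 h3 (x := y) (y := x) (z := z)
        (p := -p) (q := r) (r := q) ?_ hq ?_
      · intro t
        obtain ⟨a, b, c, s, hs, rfl⟩ := hs t
        exact ⟨b, a, c, s, hs, by abel⟩
      · rw [h y x]
        convert hmem using 1
        module
  · exact algIso_B61_of_smul_add_mem h h0 hM hd h2 h3 hs hr hmem

end CentralThree

/-! ### Type (3,1,1,1): normal forms `B62` and `B63`. -/

section UniserialTypeThree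

variable {F : Type u} [Field F] {A : Type v} [AddCommGroup A] [Module F A]
  {μ : A →ₗ[F] A →ₗ[F] A}

theorem exists_of_mem_lcs_two (h : IsAnticomm μ) (h0 : ∀ x, μ x x = 0) {x y z u : A}
    (hs : ∀ t, ∃ a b c : F, ∃ r ∈ lcs μ 1, t = a • x + b • y + c • z + r)
    (hs1 : ∀ t ∈ lcs μ 1, ∃ c : F, ∃ r ∈ lcs μ 2, t = c • u + r) {t : A} (ht : t ∈ lcs μ 2) :
    ∃ a b c : F, ∃ r ∈ lcs μ 3, t = a • μ x u + b • μ y u + c • μ z u + r := by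
  have hle : lcs μ 2 ≤ Submodule.span F {μ x u, μ y u, μ z u} ⊔ lcs μ 3 := by
    refine lcs_succ_le_iff.mpr fun p q hq => ?_
    obtain ⟨a, b, c, r, hr, rfl⟩ := hs p
    obtain ⟨k, s, hs, rfl⟩ := hs1 r hr
    obtain ⟨k', s', hs', rfl⟩ := hs1 q hq
    refine Submodule.mem_sup.mpr ⟨(a * k') • μ x u + (b * k') • μ y u + (c * k') • μ z u,
      Submodule.mem_span_triple.mpr ⟨_, _, _, rfl⟩,
      μ (a • x + b • y + c • z + (k • u + s)) s' + k' • μ s u,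
      add_mem (mul_mem_lcs_succ _ hs') (Submodule.smul_mem _ _ (h.mul_mem_lcs_succ _ hs)), ?_⟩
    simp only [map_add, map_smul, LinearMap.add_apply, LinearMap.smul_apply, h0]
    module
  obtain ⟨p, hp, r, hr, rfl⟩ := Submodule.mem_sup.mp (hle ht)
  obtain ⟨a, b, c, rfl⟩ := Submodule.mem_span_triple.mp hp
  exact ⟨a, b, c, r, hr, rfl⟩

theorem algIso_B62_of_table (hμ : IsAnticomm μ) (hμ' : ∀ x, μ x x = 0)
    (hd : Module.finrank F A = 6) (e₁ e₂ e₃ e₄ e₅ e₆ : A)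
    (hspan : ∀ y : A, ∃ c : Fin 6 → F, y = c 0 • e₁ + c 1 • e₂ + c 2 • e₃ + c 3 • e₄ + c 4 • e₅ +
      c 5 • e₆)
    (h12 : μ e₁ e₂ = e₃) (h13 : μ e₁ e₃ = 0) (h14 : μ e₁ e₄ = 0) (h15 : μ e₁ e₅ = 0)
    (h16 : μ e₁ e₆ = 0) (h23 : μ e₂ e₃ = 0) (h24 : μ e₂ e₄ = 0) (h25 : μ e₂ e₅ = 0)
    (h26 : μ e₂ e₆ = 0) (h34 : μ e₃ e₄ = e₅) (h35 : μ e₃ e₅ = 0) (h36 : μ e₃ e₆ = 0)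
    (h45 : μ e₄ e₅ = e₆) (h46 : μ e₄ e₆ = 0) (h56 : μ e₅ e₆ = 0) : AlgIso μ (B62 F) := by
  refine algIso_of_table hμ hμ' isAnticomm_B62 B62_self hd ![e₁, e₂, e₃, e₄, e₅, e₆] ?_ ?_
  · intro y
    obtain ⟨c, hc⟩ := hspan y
    exact ⟨c, by simpa [Fin.sum_univ_six] using hc⟩
  · intro i j hij
    fin_cases i <;> fin_cases j <;>
      first
      | exact absurd hij (by decide)
      | simp [Fin.sum_univ_six, B62_apply, *]

theorem algIso_B63_of_table (hμ : IsAnticomm μ) (hμ' : ∀ x, μ x x = 0)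
    (hd : Module.finrank F A = 6) (e₁ e₂ e₃ e₄ e₅ e₆ : A)
    (hspan : ∀ y : A, ∃ c : Fin 6 → F, y = c 0 • e₁ + c 1 • e₂ + c 2 • e₃ + c 3 • e₄ + c 4 • e₅ +
      c 5 • e₆)
    (h12 : μ e₁ e₂ = e₃) (h13 : μ e₁ e₃ = e₆) (h14 : μ e₁ e₄ = 0) (h15 : μ e₁ e₅ = 0)
    (h16 : μ e₁ e₆ = 0) (h23 : μ e₂ e₃ = 0) (h24 : μ e₂ e₄ = 0) (h25 : μ e₂ e₅ = 0)
    (h26 : μ e₂ e₆ = 0) (h34 : μ e₃ e₄ = e₅) (h35 : μ e₃ e₅ = 0) (h36 : μ e₃ e₆ = 0)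
    (h45 : μ e₄ e₅ = e₆) (h46 : μ e₄ e₆ = 0) (h56 : μ e₅ e₆ = 0) : AlgIso μ (B63 F) := by
  refine algIso_of_table hμ hμ' isAnticomm_B63 B63_self hd ![e₁, e₂, e₃, e₄, e₅, e₆] ?_ ?_
  · intro y
    obtain ⟨c, hc⟩ := hspan y
    exact ⟨c, by simpa [Fin.sum_univ_six] using hc⟩
  · intro i j hij
    fin_cases i <;> fin_cases j <;>
      first
      | exact absurd hij (by decide)
      | simp [Fin.sum_univ_six, B63_apply, *]

/-- The pair (a, b) is a linear form on the plane of x and y. If it vanishes, the table is that of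
`B62`; otherwise e₁ is scaled to have value 1 up to the scaling of w, and e₂ is taken in the kernel.
-/
theorem algIso_B62_or_B63_of_table (h : IsAnticomm μ) (h0 : ∀ x, μ x x = 0)
    (hd : Module.finrank F A = 6) {x y z u v w : A}
    (hspan : ∀ t : A, ∃ a b c d f g : F,
      t = a • x + b • y + c • z + d • u + f • v + g • w)
    {a b : F} (hxy : μ x y = u) (hxz : μ x z = 0) (hyz : μ y z = 0) (hxu : μ x u = a • w)
    (hyu : μ y u = b • w) (huz : μ u z = v) (hzv : μ z v = w) (hxv : μ x v = 0) (hyv : μ y v = 0)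
    (huv : μ u v = 0) (hw : ∀ t, μ t w = 0) : AlgIso μ (B62 F) ∨ AlgIso μ (B63 F) := by
  have hyx : μ y x = -u := by rw [h, hxy]
  by_cases ha : a = 0
  · by_cases hb : b = 0
    · refine Or.inl (algIso_B62_of_table h h0 hd x y u z v w ?_ hxy ?_ hxz hxv (hw _) ?_ hyz hyv
        (hw _) huz huv (hw _) hzv (hw _) (hw _))
      · intro t
        obtain ⟨a, b, c, d, f, g, rfl⟩ := hspan t
        exact ⟨![a, b, d, c, f, g], by simp; abel⟩
      · rw [hxu, ha, zero_smul]
      · rw [hyu, hb, zero_smul]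
    · refine Or.inr (algIso_B63_of_table h h0 hd (b⁻¹ • y) x (-b⁻¹ • u) z (-b⁻¹ • v) (-b⁻¹ • w)
        ?_ ?_ ?_ ?_ ?_ ?_ ?_ ?_ ?_ ?_ ?_ ?_ ?_ ?_ ?_ ?_)
      · intro t
        obtain ⟨a, c, d, f, g, k, rfl⟩ := hspan t
        refine ⟨![b * c, a, -b * f, d, -b * g, -b * k], ?_⟩
        simp
        match_scalars <;> field_simp
      all_goals simp [hyx, hxz, hyz, hxu, hyu, huz, hzv, hxv, hyv, huv, hw, ha, hb]
  · refine Or.inr (algIso_B63_of_table h h0 hd (a⁻¹ • x) (y - (b / a) • x) (a⁻¹ • u) z (a⁻¹ • v)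
      (a⁻¹ • w) ?_ ?_ ?_ ?_ ?_ ?_ ?_ ?_ ?_ ?_ ?_ ?_ ?_ ?_ ?_ ?_)
    · intro t
      obtain ⟨c, d, f, g, k, l, rfl⟩ := hspan t
      refine ⟨![a * c + b * d, d, a * g, f, a * k, a * l], ?_⟩
      simp
      match_scalars <;> field_simp
      ring
    all_goals simp [h0, hxy, hxz, hyz, hxu, hyu, huz, hzv, hxv, hyv, huv, hw, ha, smul_smul]

variable [FiniteDimensional F A]

theorem algIso_B62_or_B63_of_mul_notMem (hb : IsBinaryLie μ) (h0 : ∀ x, μ x x = 0)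
    (hd : Module.finrank F A = 6) (h1 : Module.finrank F (lcs μ 1) = 3)
    (h2 : Module.finrank F (lcs μ 2) = 2) (h3 : Module.finrank F (lcs μ 3) = 1)
    (h4 : lcs μ 4 = ⊥) {x y z : A}
    (hs : ∀ t, ∃ a b c : F, ∃ r ∈ lcs μ 1, t = a • x + b • y + c • z + r)
    (hxz : μ x z ∈ lcs μ 2) (hyz : μ y z ∈ lcs μ 2) (hxu : μ x (μ x y) ∈ lcs μ 3)
    (hyu : μ y (μ x y) ∈ lcs μ 3) (hzu : μ (μ x y) z ∉ lcs μ 3) :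
    AlgIso μ (B62 F) ∨ AlgIso μ (B63 F) := by
  have h := hb.1
  obtain ⟨u, hu⟩ : ∃ u, μ x y = u := ⟨_, rfl⟩
  obtain ⟨v, hv⟩ : ∃ v, μ u z = v := ⟨_, rfl⟩
  have hyx : μ y x = -u := by rw [h, hu]
  have hzu' : μ z u = -v := by rw [h, hv]
  rw [hu] at hxu hyu hzu
  rw [hv] at hzu
  have hu1 : u ∈ lcs μ 1 := hu ▸ mul_mem_lcs_one μ x y
  have hv2 : v ∈ lcs μ 2 := hv ▸ h.mul_mem_lcs_succ z hu1
  have hu2 : u ∉ lcs μ 2 := fun hm => hzu (hv ▸ h.mul_mem_lcs_succ z hm)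
  have hs1 : ∀ t ∈ lcs μ 1, ∃ c : F, ∃ r ∈ lcs μ 2, t = c • u + r := fun t ht =>
    exists_smul_add_of_finrank_le (U := lcs μ 2) (lcs_succ_le μ 1) (by omega) hu1 hu2 ht
  have hs2 : ∀ t ∈ lcs μ 2, ∃ c : F, ∃ r ∈ lcs μ 3, t = c • v + r := fun t ht =>
    exists_smul_add_of_finrank_le (U := lcs μ 3) (lcs_succ_le μ 2) (by omega) hv2 hzu ht
  have hr : ∀ t r, r ∈ lcs μ 3 → μ t r = 0 := fun t r hr => mul_eq_zero_of_lcs_eq_bot h4 t hr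
  have hl : ∀ t r, r ∈ lcs μ 3 → μ r t = 0 := fun t r hr => h.mul_eq_zero_of_lcs_eq_bot h4 t hr
  have hll : ∀ s t r, r ∈ lcs μ 2 → μ (μ r s) t = 0 := fun s t r hr =>
    hl t _ (h.mul_mem_lcs_succ s hr)
  have hlr : ∀ s t r, r ∈ lcs μ 2 → μ (μ s r) t = 0 := fun s t r hr =>
    hl t _ (mul_mem_lcs_succ s hr)
  have h22 : ∀ s ∈ lcs μ 2, ∀ t ∈ lcs μ 2, μ s t = 0 := by
    intro s hs t ht
    obtain ⟨c, r, hr', rfl⟩ := hs2 s hs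
    obtain ⟨c', r', hr'', rfl⟩ := hs2 t ht
    simp [h0, hr _ _ hr'', hl _ _ hr']
  have hux : μ u x ∈ lcs μ 3 := by
    rw [h]
    exact neg_mem hxu
  have huy : μ u y ∈ lcs μ 3 := by
    rw [h]
    exact neg_mem hyu
  have hxv : μ x v = 0 := by
    have hp := hb.polarized x y z
    simp only [jacobian, hu, hll _ _ _ hxz, hlr _ _ _ hxz, hl z _ hux, hzu', map_neg,
      LinearMap.neg_apply, h (μ x z) u, h v x, neg_neg, zero_add, add_zero] at hp
    simpa using hp
  have hyv : μ y v = 0 := by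
    have hp := hb.polarized y x z
    simp only [jacobian, hyx, hll _ _ _ hyz, hlr _ _ _ hyz, hl z _ huy, hzu', map_neg,
      LinearMap.neg_apply, h (μ y z) u, h v y, neg_neg, zero_add, add_zero, neg_zero] at hp
    simpa using hp
  have huv : μ u v = 0 := by
    -- The term [u,v] is a cross term between [x,y] = u and [z,u] = -v, so the identity has to be
    -- taken at x + z.
    have hp := hb.polarized (x + z) y u
    have e1 : μ (x + z) y = u + μ z y := by rw [map_add, LinearMap.add_apply, hu]
    have e2 : μ (x + z) u = μ x u - v := by
      rw [map_add, LinearMap.add_apply, hzu', sub_eq_add_neg]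
    have hzy : μ z y ∈ lcs μ 2 := by
      rw [h]
      exact neg_mem hyz
    have hx2 : μ x u - v ∈ lcs μ 2 := sub_mem (lcs_succ_le μ 2 hxu) hv2
    have e3 : μ u (x + z) = v - μ x u := by rw [h, e2, neg_sub]
    have e4 : μ u (μ x u) = 0 := hr _ _ hxu
    have e5 : μ (μ x u) u = 0 := hl _ _ hxu
    have j1 : jacobian μ (u + μ z y) (x + z) u = 0 := by
      have f1 : μ (u + μ z y) (x + z) = v - μ x u + μ (μ z y) (x + z) := by
        rw [μ.map_add, LinearMap.add_apply, e3]
      have f2 : μ u (u + μ z y) = μ u (μ z y) := by rw [map_add, h0, zero_add]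
      rw [jacobian, f1, f2, e2, hlr _ _ _ hzy, map_add, LinearMap.add_apply, hll _ _ _ hzy,
        map_add, h22 _ hx2 _ hzy]
      simp [e5]
    have j2 : jacobian μ (μ x u - v) (x + z) y = -μ u v := by
      rw [jacobian, hll _ _ _ hx2, hlr _ _ _ hx2, e1, map_add, LinearMap.add_apply,
        h22 _ hzy _ hx2, map_sub, e4]
      simp
    rw [e1, e2, j1, j2] at hp
    simpa using hp
  have hs3 : ∀ t ∈ lcs μ 3, ∃ c : F, t = c • μ z v := by
    have hle : lcs μ 3 ≤ Submodule.span F {μ z v} := by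
      refine lcs_succ_le_iff.mpr fun p q hq => ?_
      obtain ⟨a, b, c, r, hr', rfl⟩ := hs p
      obtain ⟨d, s, hs', rfl⟩ := hs1 r hr'
      obtain ⟨k, t, ht, rfl⟩ := hs2 q hq
      refine Submodule.mem_span_singleton.mpr ⟨c * k, ?_⟩
      simp [hr _ _ ht, hxv, hyv, huv, h22 _ hs' _ hv2, smul_smul]
    intro t ht
    obtain ⟨c, rfl⟩ := Submodule.mem_span_singleton.mp (hle ht)
    exact ⟨c, rfl⟩
  obtain ⟨w, hw⟩ : ∃ w, μ z v = w := ⟨_, rfl⟩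
  rw [hw] at hs3
  have hw3 : w ∈ lcs μ 3 := hw ▸ mul_mem_lcs_succ z hv2
  have hrw : ∀ t, μ t w = 0 := fun t => hr t w hw3
  have hlw : ∀ t, μ w t = 0 := fun t => hl t w hw3
  obtain ⟨a, ha⟩ := hs3 _ hxu
  obtain ⟨b, hb'⟩ := hs3 _ hyu
  have hs2' : ∀ t ∈ lcs μ 2, ∃ c d : F, t = c • v + d • w := by
    intro t ht
    obtain ⟨c, r, hr, rfl⟩ := hs2 t ht
    obtain ⟨d, rfl⟩ := hs3 r hr
    exact ⟨c, d, rfl⟩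
  obtain ⟨p, p', hp⟩ := hs2' _ hxz
  obtain ⟨q, q', hq⟩ := hs2' _ hyz
  have hvy : μ v y = 0 := by rw [h, hyv, neg_zero]
  have hvu : μ v u = 0 := by rw [h, huv, neg_zero]
  have hvz : μ v z = -w := by rw [h, hw]
  have huy' : μ u y = -(b • w) := by rw [h, hb']
  -- Since [u,z] = v and [v,z] = -w, these corrections cancel [x,z] = pv + p'w and [y,z] = qv + q'w.
  -- The new u is the product of the new x and y.
  refine algIso_B62_or_B63_of_table h h0 hd (x := x - p • u + p' • v) (y := y - q • u + q' • v)
    (z := z) (u := u - (a * q) • w + (b * p) • w) (v := v) (w := w) (a := a) (b := b)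
    ?_ ?_ ?_ ?_ ?_ ?_ ?_ ?_ ?_ ?_ ?_ hrw
  · intro t
    obtain ⟨c1, c2, c3, r, hr1, rfl⟩ := hs t
    obtain ⟨c4, s, hs', rfl⟩ := hs1 r hr1
    obtain ⟨c5, c6, rfl⟩ := hs2' s hs'
    exact ⟨c1, c2, c3, c4 + c1 * p + c2 * q, c5 - c1 * p' - c2 * q',
      c6 + (c4 + c1 * p + c2 * q) * (a * q - b * p), by module⟩
  all_goals
    simp only [map_add, map_sub, map_smul, LinearMap.add_apply, LinearMap.sub_apply,
      LinearMap.smul_apply, hu, hv, hw, h0, hxv, hyv, huv, hvy, hvu, hvz, hrw, hlw, ha, hb', huy',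
      hp, hq, smul_zero, smul_neg]
    try module

end UniserialTypeThree

/-! ### Structure constants of the types on which binary Lie implies Malcev. -/

section Coordinates

variable {F : Type u} [Field F]

/-- The multiplications with three generators whose lower central factors have dimensions
`3, 1, 1, 1` and in which the product of the generators `0` and `1` has its product with the
generator `0`, but not with `1` or `2`, outside the last factor. -/
def threeGenAlg (p p' q q' k l r s t c : F) :
    (Fin 6 → F) →ₗ[F] (Fin 6 → F) →ₗ[F] (Fin 6 → F) :=
  prod F 0 1 3 + p • prod F 0 2 4 + p' • prod F 0 2 5 + q • prod F 1 2 4 + q' • prod F 1 2 5 +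
    prod F 0 3 4 + k • prod F 1 3 5 + l • prod F 2 3 5 + r • prod F 0 4 5 + s • prod F 1 4 5 +
    t • prod F 2 4 5 + c • prod F 3 4 5

theorem threeGenAlg_apply (p p' q q' k l r s t c : F) (x y : Fin 6 → F) :
    threeGenAlg p p' q q' k l r s t c x y = ![0, 0, 0, x 0 * y 1 - x 1 * y 0,
      p * (x 0 * y 2 - x 2 * y 0) + q * (x 1 * y 2 - x 2 * y 1) + (x 0 * y 3 - x 3 * y 0),
      p' * (x 0 * y 2 - x 2 * y 0) + q' * (x 1 * y 2 - x 2 * y 1) + k * (x 1 * y 3 - x 3 * y 1) +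
      l * (x 2 * y 3 - x 3 * y 2) + r * (x 0 * y 4 - x 4 * y 0) + s * (x 1 * y 4 - x 4 * y 1) +
      t * (x 2 * y 4 - x 4 * y 2) + c * (x 3 * y 4 - x 4 * y 3)] := by
  ext i
  fin_cases i <;> simp [threeGenAlg, prod_apply]

theorem isAnticomm_threeGenAlg (p p' q q' k l r s t c : F) :
    IsAnticomm (threeGenAlg p p' q q' k l r s t c) := by
  intro x y
  ext i
  fin_cases i <;> simp [threeGenAlg_apply] <;> ring

theorem threeGenAlg_self (p p' q q' k l r s t c : F) (x : Fin 6 → F) :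
    threeGenAlg p p' q q' k l r s t c x x = 0 := by
  simp [threeGenAlg, prod_self]

/-- The three identities give s = t = c = 0. Then the Jacobian has central values and vanishes when
an argument is a product, so both sides of the Malcev identity are zero. -/
theorem isMalcev_threeGenAlg {p p' q q' k l r s t c : F}
    (h : IsBinaryLie (threeGenAlg p p' q q' k l r s t c)) :
    IsMalcev (threeGenAlg p p' q q' k l r s t c) := by
  have h1 := congrFun (h.2 (Pi.single 0 1) (Pi.single 1 1)) 5
  simp [jacobian, threeGenAlg_apply] at h1
  have h2 := congrFun (h.polarized (Pi.single 0 1) (Pi.single 1 1) (Pi.single 2 1)) 5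
  simp [jacobian, threeGenAlg_apply] at h2
  have h3 := congrFun (h.polarized (Pi.single 0 1) (Pi.single 1 1) (Pi.single 3 1)) 5
  simp [jacobian, threeGenAlg_apply] at h3
  subst h1 h2 h3
  refine ⟨h.1, fun x y z => ?_⟩
  ext i
  fin_cases i <;> simp [jacobian, threeGenAlg_apply]
  all_goals ring

/-- The multiplications with two generators whose lower central factors have dimensions
`2, 1, 2, 1`. -/
def shortTwoGenAlg (p q q' s k l m : F) : (Fin 6 → F) →ₗ[F] (Fin 6 → F) →ₗ[F] (Fin 6 → F) :=
  prod F 0 1 2 + prod F 0 2 3 + prod F 1 2 4 + p • prod F 0 3 5 + q • prod F 0 4 5 +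
    q' • prod F 1 3 5 + s • prod F 1 4 5 + k • prod F 2 3 5 + l • prod F 2 4 5 + m • prod F 3 4 5

theorem shortTwoGenAlg_apply (p q q' s k l m : F) (x y : Fin 6 → F) :
    shortTwoGenAlg p q q' s k l m x y = ![0, 0, x 0 * y 1 - x 1 * y 0, x 0 * y 2 - x 2 * y 0,
      x 1 * y 2 - x 2 * y 1,
      p * (x 0 * y 3 - x 3 * y 0) + q * (x 0 * y 4 - x 4 * y 0) + q' * (x 1 * y 3 - x 3 * y 1) +
      s * (x 1 * y 4 - x 4 * y 1) + k * (x 2 * y 3 - x 3 * y 2) + l * (x 2 * y 4 - x 4 * y 2) +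
      m * (x 3 * y 4 - x 4 * y 3)] := by
  ext i
  fin_cases i <;> simp [shortTwoGenAlg, prod_apply]

theorem isAnticomm_shortTwoGenAlg (p q q' s k l m : F) :
    IsAnticomm (shortTwoGenAlg p q q' s k l m) := by
  intro x y
  ext i
  fin_cases i <;> simp [shortTwoGenAlg_apply] <;> ring

theorem shortTwoGenAlg_self (p q q' s k l m : F) (x : Fin 6 → F) :
    shortTwoGenAlg p q q' s k l m x x = 0 := by
  simp [shortTwoGenAlg, prod_self]

/-- The identities give q' = q and k = l = m = 0, and what remains is a Lie algebra. -/
theorem isMalcev_shortTwoGenAlg {p q q' s k l m : F}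
    (h : IsBinaryLie (shortTwoGenAlg p q q' s k l m)) :
    IsMalcev (shortTwoGenAlg p q q' s k l m) := by
  have h1 := congrFun (h.2 (Pi.single 0 1) (Pi.single 1 1)) 5
  simp [jacobian, shortTwoGenAlg_apply] at h1
  have h2 := congrFun (h.polarized (Pi.single 0 1) (Pi.single 1 1) (Pi.single 2 1)) 5
  simp [jacobian, shortTwoGenAlg_apply] at h2
  have h3 := congrFun (h.polarized (Pi.single 1 1) (Pi.single 0 1) (Pi.single 2 1)) 5
  simp [jacobian, shortTwoGenAlg_apply] at h3
  have h4 := congrFun (h.polarized (Pi.single 0 1) (Pi.single 1 1) (Pi.single 4 1)) 5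
  simp [jacobian, shortTwoGenAlg_apply] at h4
  obtain rfl : q' = q := by linear_combination h1
  subst h2 h3 h4
  refine isMalcev_of_jacobian_eq_zero h.1 fun x y z => ?_
  ext i
  fin_cases i <;> simp [jacobian, shortTwoGenAlg_apply]
  all_goals ring

/-- The multiplications with two generators whose lower central factors have dimensions
`2, 1, 1, 1, 1`. -/
def longTwoGenAlg (b b' s m t r k l : F) :
    (Fin 6 → F) →ₗ[F] (Fin 6 → F) →ₗ[F] (Fin 6 → F) :=
  prod F 0 1 2 + prod F 0 2 3 + b • prod F 1 2 4 + b' • prod F 1 2 5 + prod F 0 3 4 +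
    s • prod F 0 4 5 + m • prod F 1 3 5 + t • prod F 1 4 5 + r • prod F 2 3 5 +
    k • prod F 2 4 5 + l • prod F 3 4 5

theorem longTwoGenAlg_apply (b b' s m t r k l : F) (x y : Fin 6 → F) :
    longTwoGenAlg b b' s m t r k l x y =
      ![0, 0, x 0 * y 1 - x 1 * y 0, x 0 * y 2 - x 2 * y 0,
      b * (x 1 * y 2 - x 2 * y 1) + (x 0 * y 3 - x 3 * y 0),
      b' * (x 1 * y 2 - x 2 * y 1) + s * (x 0 * y 4 - x 4 * y 0) +
      m * (x 1 * y 3 - x 3 * y 1) + t * (x 1 * y 4 - x 4 * y 1) + r * (x 2 * y 3 - x 3 * y 2) +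
      k * (x 2 * y 4 - x 4 * y 2) + l * (x 3 * y 4 - x 4 * y 3)] := by
  ext i
  fin_cases i <;> simp [longTwoGenAlg, prod_apply]

theorem isAnticomm_longTwoGenAlg (b b' s m t r k l : F) :
    IsAnticomm (longTwoGenAlg b b' s m t r k l) := by
  intro x y
  ext i
  fin_cases i <;> simp [longTwoGenAlg_apply] <;> ring

theorem longTwoGenAlg_self (b b' s m t r k l : F) (x : Fin 6 → F) :
    longTwoGenAlg b b' s m t r k l x x = 0 := by
  simp [longTwoGenAlg, prod_self]

/-- The identities give m = sb, r = -t and k = l = 0, and what remains is a Lie algebra. -/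
theorem isMalcev_longTwoGenAlg {b b' s m t r k l : F}
    (h : IsBinaryLie (longTwoGenAlg b b' s m t r k l)) :
    IsMalcev (longTwoGenAlg b b' s m t r k l) := by
  have h1 := congrFun (h.2 (Pi.single 0 1) (Pi.single 1 1)) 5
  simp [jacobian, longTwoGenAlg_apply] at h1
  have h2 := congrFun (h.polarized (Pi.single 0 1) (Pi.single 1 1) (Pi.single 2 1)) 5
  simp [jacobian, longTwoGenAlg_apply] at h2
  have h3 := congrFun (h.2 (Pi.single 0 1) (Pi.single 2 1)) 5
  simp [jacobian, longTwoGenAlg_apply] at h3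
  have h4 := congrFun (h.polarized (Pi.single 0 1) (Pi.single 2 1) (Pi.single 3 1)) 5
  simp [jacobian, longTwoGenAlg_apply] at h4
  obtain rfl : m = s * b := by linear_combination h1
  obtain rfl : r = -t := by linear_combination h2
  subst h3 h4
  refine isMalcev_of_jacobian_eq_zero h.1 fun x y z => ?_
  ext i
  fin_cases i <;> simp [jacobian, longTwoGenAlg_apply]
  all_goals ring

end Coordinates

/-! ### Type (3,1,1,1): choice of generators. -/

section Reduction

variable {F : Type u} [Field F] {A : Type v} [AddCommGroup A] [Module F A]
  {μ : A →ₗ[F] A →ₗ[F] A} [FiniteDimensional F A]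

theorem isMalcev_of_mul_radical_mem_of_mul_mem (hb : IsBinaryLie μ) (h0 : ∀ x, μ x x = 0)
    (hd : Module.finrank F A = 6) (h1 : Module.finrank F (lcs μ 1) = 3)
    (h2 : Module.finrank F (lcs μ 2) = 2) (h3 : Module.finrank F (lcs μ 3) = 1)
    (h4 : lcs μ 4 = ⊥) {x y z : A}
    (hs : ∀ t, ∃ a b c : F, ∃ r ∈ lcs μ 1, t = a • x + b • y + c • z + r)
    (hxz : μ x z ∈ lcs μ 2) (hyz : μ y z ∈ lcs μ 2) (hxu : μ x (μ x y) ∉ lcs μ 3)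
    (hyu : μ y (μ x y) ∈ lcs μ 3) (hzu : μ z (μ x y) ∈ lcs μ 3) : IsMalcev μ := by
  have h := hb.1
  obtain ⟨u, hu⟩ : ∃ u, μ x y = u := ⟨_, rfl⟩
  obtain ⟨v, hv⟩ : ∃ v, μ x u = v := ⟨_, rfl⟩
  rw [hu] at hxu hyu hzu
  rw [hv] at hxu
  have hu1 : u ∈ lcs μ 1 := hu ▸ mul_mem_lcs_one μ x y
  have hv2 : v ∈ lcs μ 2 := hv ▸ mul_mem_lcs_succ x hu1
  have hu2 : u ∉ lcs μ 2 := fun hm => hxu (hv ▸ mul_mem_lcs_succ x hm)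
  obtain ⟨w, hw, hw0⟩ := exists_mem_notMem_of_finrank_lt (U := ⊥) (V := lcs μ 3) (by simp [h3])
  have hs3 : ∀ t ∈ lcs μ 3, ∃ c : F, t = c • w := fun t ht =>
    exists_smul_of_finrank_le_one h3.le hw (by simpa using hw0) ht
  have hs2 : ∀ t ∈ lcs μ 2, ∃ c d : F, t = c • v + d • w := by
    intro t ht
    obtain ⟨c, r, hr, rfl⟩ := exists_smul_add_of_finrank_le (U := lcs μ 3) (lcs_succ_le μ 2)
      (by omega) hv2 hxu ht
    obtain ⟨d, rfl⟩ := hs3 r hr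
    exact ⟨c, d, rfl⟩
  obtain ⟨p, p', hp⟩ := hs2 _ hxz
  obtain ⟨q, q', hq⟩ := hs2 _ hyz
  obtain ⟨k, hk⟩ := hs3 _ hyu
  obtain ⟨l, hl⟩ := hs3 _ hzu
  obtain ⟨r, hr⟩ := hs3 _ (mul_mem_lcs_succ x hv2)
  obtain ⟨s, hs'⟩ := hs3 _ (mul_mem_lcs_succ y hv2)
  obtain ⟨t, ht⟩ := hs3 _ (mul_mem_lcs_succ z hv2)
  obtain ⟨c, hc⟩ := hs3 _ (mul_mem_lcs_succ u hv2)
  have hw' : ∀ t, μ t w = 0 := fun t => mul_eq_zero_of_lcs_eq_bot h4 t hw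
  have hiso : AlgIso μ (threeGenAlg p p' q q' k l r s t c) := by
    refine algIso_of_table h h0 (isAnticomm_threeGenAlg p p' q q' k l r s t c)
      (threeGenAlg_self p p' q q' k l r s t c) hd ![x, y, z, u, v, w] ?_ ?_
    · intro t
      obtain ⟨c1, c2, c3, r, hr, rfl⟩ := hs t
      obtain ⟨c4, g, hg, rfl⟩ := exists_smul_add_of_finrank_le (U := lcs μ 2) (lcs_succ_le μ 1)
        (by omega) hu1 hu2 hr
      obtain ⟨c5, c6, rfl⟩ := hs2 g hg
      exact ⟨![c1, c2, c3, c4, c5, c6], by simp [Fin.sum_univ_six]; abel⟩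
    · intro i j hij
      fin_cases i <;> fin_cases j <;>
        first
        | exact absurd hij (by decide)
        | simp [Fin.sum_univ_six, threeGenAlg_apply, *]
  exact hiso.isMalcev (isMalcev_threeGenAlg (hiso.symm.isBinaryLie hb))

/-- Replacing y by y - cx keeps [x,y] and moves its product with y into `lcs μ 3`, as the coordinate
form requires. -/
theorem isMalcev_of_mul_radical_mem (hb : IsBinaryLie μ) (h0 : ∀ x, μ x x = 0)
    (hd : Module.finrank F A = 6) (h1 : Module.finrank F (lcs μ 1) = 3)
    (h2 : Module.finrank F (lcs μ 2) = 2) (h3 : Module.finrank F (lcs μ 3) = 1)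
    (h4 : lcs μ 4 = ⊥) {x y z : A}
    (hs : ∀ t, ∃ a b c : F, ∃ r ∈ lcs μ 1, t = a • x + b • y + c • z + r)
    (hxz : μ x z ∈ lcs μ 2) (hyz : μ y z ∈ lcs μ 2) (hxu : μ x (μ x y) ∉ lcs μ 3)
    (hzu : μ z (μ x y) ∈ lcs μ 3) : IsMalcev μ := by
  obtain ⟨c, r, hr, hc⟩ := exists_smul_add_of_finrank_le (U := lcs μ 3) (lcs_succ_le μ 2)
    (by omega) (mul_mem_lcs_succ x (mul_mem_lcs_one μ x y)) hxu
    (mul_mem_lcs_succ y (mul_mem_lcs_one μ x y))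
  have e : μ x (y - c • x) = μ x y := by rw [map_sub, map_smul, h0, smul_zero, sub_zero]
  refine isMalcev_of_mul_radical_mem_of_mul_mem hb h0 hd h1 h2 h3 h4 (x := x) (y := y - c • x)
    (z := z) ?_ hxz ?_ (by rwa [e]) ?_ (by rwa [e])
  · intro t
    obtain ⟨a, b, c', s, hs', rfl⟩ := hs t
    exact ⟨a + b * c, b, c', s, hs', by module⟩
  · rw [map_sub, map_smul, LinearMap.sub_apply, LinearMap.smul_apply]
    exact sub_mem hyz (Submodule.smul_mem _ _ hxz)
  · rw [e, map_sub, map_smul, LinearMap.sub_apply, LinearMap.smul_apply, hc, add_sub_cancel_left]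
    exact hr

theorem algIso_B62_or_B63_of_mul_notMem_radical (hb : IsBinaryLie μ) (h0 : ∀ x, μ x x = 0)
    (hM : ¬ IsMalcev μ)
    (hd : Module.finrank F A = 6) (h1 : Module.finrank F (lcs μ 1) = 3)
    (h2 : Module.finrank F (lcs μ 2) = 2) (h3 : Module.finrank F (lcs μ 3) = 1)
    (h4 : lcs μ 4 = ⊥) {x y z : A}
    (hs : ∀ t, ∃ a b c : F, ∃ r ∈ lcs μ 1, t = a • x + b • y + c • z + r)
    (hxy : μ x y ∉ lcs μ 2) (hxz : μ x z ∈ lcs μ 2) (hyz : μ y z ∈ lcs μ 2) :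
    AlgIso μ (B62 F) ∨ AlgIso μ (B63 F) := by
  have h := hb.1
  have hu1 := mul_mem_lcs_one μ x y
  by_cases hzu : μ (μ x y) z ∈ lcs μ 3
  · exfalso
    have hzu' : μ z (μ x y) ∈ lcs μ 3 := by
      rw [h]
      exact neg_mem hzu
    by_cases hxu : μ x (μ x y) ∈ lcs μ 3
    · by_cases hyu : μ y (μ x y) ∈ lcs μ 3
      · have hle : lcs μ 2 ≤ lcs μ 3 := by
          intro t ht
          obtain ⟨a, b, c, r, hr, rfl⟩ := exists_of_mem_lcs_two h h0 hs
            (fun t ht => exists_smul_add_of_finrank_le (U := lcs μ 2) (lcs_succ_le μ 1)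
              (by omega) hu1 hxy ht) ht
          exact add_mem (add_mem (add_mem (Submodule.smul_mem _ _ hxu)
            (Submodule.smul_mem _ _ hyu)) (Submodule.smul_mem _ _ hzu')) hr
        have := Submodule.finrank_mono hle
        omega
      · refine hM (isMalcev_of_mul_radical_mem hb h0 hd h1 h2 h3 h4 (x := y) (y := x) (z := z)
          ?_ hyz hxz ?_ ?_)
        · intro t
          obtain ⟨a, b, c, r, hr, rfl⟩ := hs t
          exact ⟨b, a, c, r, hr, by abel⟩
        · rwa [h y x, map_neg, neg_mem_iff]
        · rwa [h y x, map_neg, neg_mem_iff]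
    · exact hM (isMalcev_of_mul_radical_mem hb h0 hd h1 h2 h3 h4 hs hxz hyz hxu hzu')
  · have hv := h.mul_mem_lcs_succ z hu1
    obtain ⟨a, r, hr, ha⟩ := exists_smul_add_of_finrank_le (U := lcs μ 3) (lcs_succ_le μ 2)
      (by omega) hv hzu (mul_mem_lcs_succ x hu1)
    obtain ⟨b, s, hs', hb'⟩ := exists_smul_add_of_finrank_le (U := lcs μ 3) (lcs_succ_le μ 2)
      (by omega) hv hzu (mul_mem_lcs_succ y hu1)
    -- Modulo `lcs μ 3` the products of x and y with u = [x,y] are a[u,z] and b[u,z], so adding az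
    -- and bz removes them; as z is radical, [x,y] is unchanged modulo `lcs μ 2`.
    obtain ⟨g, hg, he⟩ : ∃ g ∈ lcs μ 2, μ (x + a • z) (y + b • z) = μ x y + g := by
      refine ⟨b • μ x z - a • μ y z,
        sub_mem (Submodule.smul_mem _ _ hxz) (Submodule.smul_mem _ _ hyz), ?_⟩
      simp only [map_add, map_smul, LinearMap.add_apply, LinearMap.smul_apply, h0, h z y]
      module
    refine algIso_B62_or_B63_of_mul_notMem hb h0 hd h1 h2 h3 h4 (x := x + a • z)
      (y := y + b • z) (z := z) ?_ ?_ ?_ ?_ ?_ ?_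
    · intro t
      obtain ⟨c1, c2, c3, r, hr, rfl⟩ := hs t
      exact ⟨c1, c2, c3 - c1 * a - c2 * b, r, hr, by module⟩
    · simpa [h0] using hxz
    · simpa [h0] using hyz
    · rw [he, map_add]
      refine add_mem ?_ (mul_mem_lcs_succ _ hg)
      rw [map_add, LinearMap.add_apply, map_smul, LinearMap.smul_apply, ha, h z]
      convert hr using 1
      module
    · rw [he, map_add]
      refine add_mem ?_ (mul_mem_lcs_succ _ hg)
      rw [map_add, LinearMap.add_apply, map_smul, LinearMap.smul_apply, hb', h z]
      convert hs' using 1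
      module
    · rw [he, map_add, LinearMap.add_apply]
      exact fun hm => hzu ((add_mem_cancel_right (h.mul_mem_lcs_succ z hg)).mp hm)

theorem algIso_B62_or_B63_of_mul_notMem_lcs_two (hb : IsBinaryLie μ) (h0 : ∀ x, μ x x = 0)
    (hM : ¬ IsMalcev μ)
    (hd : Module.finrank F A = 6) (h1 : Module.finrank F (lcs μ 1) = 3)
    (h2 : Module.finrank F (lcs μ 2) = 2) (h3 : Module.finrank F (lcs μ 3) = 1)
    (h4 : lcs μ 4 = ⊥) {x y z : A}
    (hs : ∀ t, ∃ a b c : F, ∃ r ∈ lcs μ 1, t = a • x + b • y + c • z + r)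
    (hxy : μ x y ∉ lcs μ 2) : AlgIso μ (B62 F) ∨ AlgIso μ (B63 F) := by
  have h := hb.1
  have hs1 : ∀ t ∈ lcs μ 1, ∃ c : F, ∃ r ∈ lcs μ 2, t = c • μ x y + r := fun t ht =>
    exists_smul_add_of_finrank_le (U := lcs μ 2) (lcs_succ_le μ 1) (by omega)
      (mul_mem_lcs_one μ x y) hxy ht
  obtain ⟨a, r, hr, ha⟩ := hs1 _ (mul_mem_lcs_one μ x z)
  obtain ⟨b, s, hs', hb'⟩ := hs1 _ (mul_mem_lcs_one μ y z)
  -- The new z spans the radical of the alternating form induced on A modulo `lcs μ 1`.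
  refine algIso_B62_or_B63_of_mul_notMem_radical hb h0 hM hd h1 h2 h3 h4 (x := x) (y := y)
    (z := z - a • y + b • x) ?_ hxy ?_ ?_
  · intro t
    obtain ⟨c1, c2, c3, r, hr, rfl⟩ := hs t
    exact ⟨c1 - c3 * b, c2 + c3 * a, c3, r, hr, by module⟩
  · convert hr using 1
    simp only [map_add, map_sub, map_smul, h0, ha]
    module
  · convert hs' using 1
    simp only [map_add, map_sub, map_smul, h0, hb', h y x]
    module

theorem algIso_B62_or_B63_of_finrank (hb : IsBinaryLie μ) (h0 : ∀ x, μ x x = 0)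
    (hM : ¬ IsMalcev μ)
    (hd : Module.finrank F A = 6) (h1 : Module.finrank F (lcs μ 1) = 3)
    (h2 : Module.finrank F (lcs μ 2) = 2) (h3 : Module.finrank F (lcs μ 3) = 1)
    (h4 : lcs μ 4 = ⊥) : AlgIso μ (B62 F) ∨ AlgIso μ (B63 F) := by
  obtain ⟨x, -, y, -, z, -, hs⟩ := exists_triple_of_finrank_eq (U := lcs μ 1)
    (V := (⊤ : Submodule F A)) le_top (by rw [finrank_top, hd, h1])
  replace hs := fun t => hs t Submodule.mem_top
  by_cases hxy : μ x y ∈ lcs μ 2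
  · by_cases hxz : μ x z ∈ lcs μ 2
    · have hyz : μ y z ∉ lcs μ 2 := by
        intro hyz
        have hle : lcs μ 1 ≤ lcs μ 2 := by
          intro t ht
          obtain ⟨a, b, c, r, hr, rfl⟩ := exists_of_mem_lcs_one hb.1 h0 hs ht
          exact add_mem (add_mem (add_mem (Submodule.smul_mem _ _ hxy)
            (Submodule.smul_mem _ _ hxz)) (Submodule.smul_mem _ _ hyz)) hr
        have := Submodule.finrank_mono hle
        omega
      refine algIso_B62_or_B63_of_mul_notMem_lcs_two hb h0 hM hd h1 h2 h3 h4 (z := x) ?_ hyz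
      intro t
      obtain ⟨a, b, c, r, hr, rfl⟩ := hs t
      exact ⟨b, c, a, r, hr, by abel⟩
    · refine algIso_B62_or_B63_of_mul_notMem_lcs_two hb h0 hM hd h1 h2 h3 h4 (z := y) ?_ hxz
      intro t
      obtain ⟨a, b, c, r, hr, rfl⟩ := hs t
      exact ⟨a, c, b, r, hr, by abel⟩
  · exact algIso_B62_or_B63_of_mul_notMem_lcs_two hb h0 hM hd h1 h2 h3 h4 hs hxy

end Reduction

/-! ### Two generators, and the final case division. -/

section TwoGenerators

variable {F : Type u} [Field F] {A : Type v} [AddCommGroup A] [Module F A]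
  {μ : A →ₗ[F] A →ₗ[F] A}

theorem exists_of_mem_lcs_one_of_pair (h : IsAnticomm μ) (h0 : ∀ x, μ x x = 0) {x y : A}
    (hs : ∀ t, ∃ a b : F, ∃ r ∈ lcs μ 1, t = a • x + b • y + r) {t : A}
    (ht : t ∈ lcs μ 1) : ∃ c : F, ∃ r ∈ lcs μ 2, t = c • μ x y + r := by
  -- The statement for three generators is applied with third generator 0.
  obtain ⟨a, b, c, r, hr, rfl⟩ := exists_of_mem_lcs_one h h0 (x := x) (y := y) (z := 0)
    (fun t => by
      obtain ⟨a, b, r, hr, rfl⟩ := hs t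
      exact ⟨a, b, 0, r, hr, by module⟩) ht
  exact ⟨a, r, hr, by simp⟩

theorem exists_of_mem_lcs_two_of_pair (h : IsAnticomm μ) (h0 : ∀ x, μ x x = 0) {x y : A}
    (hs : ∀ t, ∃ a b : F, ∃ r ∈ lcs μ 1, t = a • x + b • y + r) {t : A}
    (ht : t ∈ lcs μ 2) :
    ∃ a b : F, ∃ r ∈ lcs μ 3, t = a • μ x (μ x y) + b • μ y (μ x y) + r := by
  obtain ⟨a, b, c, r, hr, rfl⟩ := exists_of_mem_lcs_two h h0 (x := x) (y := y) (z := 0)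
    (fun t => by
      obtain ⟨a, b, r, hr, rfl⟩ := hs t
      exact ⟨a, b, 0, r, hr, by module⟩)
    (fun t ht => exists_of_mem_lcs_one_of_pair h h0 hs ht) ht
  exact ⟨a, b, r, hr, by simp⟩

variable [FiniteDimensional F A]

theorem isMalcev_of_pair_of_finrank_eq_one (hb : IsBinaryLie μ) (h0 : ∀ x, μ x x = 0)
    (hd : Module.finrank F A = 6) (h3 : Module.finrank F (lcs μ 3) = 1) (h4 : lcs μ 4 = ⊥)
    {x y : A} (hs : ∀ t, ∃ a b : F, ∃ r ∈ lcs μ 1, t = a • x + b • y + r) : IsMalcev μ := by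
  have h := hb.1
  have hs1 := fun t ht => exists_of_mem_lcs_one_of_pair h h0 hs (t := t) ht
  have hs2 := fun t ht => exists_of_mem_lcs_two_of_pair h h0 hs (t := t) ht
  have hu1 := mul_mem_lcs_one μ x y
  obtain ⟨u, hu⟩ : ∃ u, μ x y = u := ⟨_, rfl⟩
  obtain ⟨v, hv⟩ : ∃ v, μ x u = v := ⟨_, rfl⟩
  obtain ⟨v', hv'⟩ : ∃ v', μ y u = v' := ⟨_, rfl⟩
  rw [hu] at hu1 hs1 hs2
  rw [hv, hv'] at hs2
  have hv2 : v ∈ lcs μ 2 := hv ▸ mul_mem_lcs_succ x hu1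
  have hv2' : v' ∈ lcs μ 2 := hv' ▸ mul_mem_lcs_succ y hu1
  obtain ⟨w, hw, hw0⟩ := exists_mem_notMem_of_finrank_lt (U := ⊥) (V := lcs μ 3) (by simp [h3])
  have hs3 : ∀ t ∈ lcs μ 3, ∃ c : F, t = c • w := fun t ht =>
    exists_smul_of_finrank_le_one h3.le hw (by simpa using hw0) ht
  have hw' : ∀ t, μ t w = 0 := fun t => mul_eq_zero_of_lcs_eq_bot h4 t hw
  obtain ⟨p, hp⟩ := hs3 _ (mul_mem_lcs_succ x hv2)
  obtain ⟨q, hq⟩ := hs3 _ (mul_mem_lcs_succ x hv2')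
  obtain ⟨q', hq'⟩ := hs3 _ (mul_mem_lcs_succ y hv2)
  obtain ⟨s, hs'⟩ := hs3 _ (mul_mem_lcs_succ y hv2')
  obtain ⟨k, hk⟩ := hs3 _ (mul_mem_lcs_succ u hv2)
  obtain ⟨l, hl⟩ := hs3 _ (mul_mem_lcs_succ u hv2')
  obtain ⟨m, hm⟩ := hs3 _ (mul_mem_lcs_succ v hv2')
  have hiso : AlgIso μ (shortTwoGenAlg p q q' s k l m) := by
    refine algIso_of_table h h0 (isAnticomm_shortTwoGenAlg p q q' s k l m)
      (shortTwoGenAlg_self p q q' s k l m) hd ![x, y, u, v, v', w] ?_ ?_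
    · intro t
      obtain ⟨c1, c2, r, hr, rfl⟩ := hs t
      obtain ⟨c3, g, hg, rfl⟩ := hs1 r hr
      obtain ⟨c4, c5, f, hf, rfl⟩ := hs2 g hg
      obtain ⟨c6, rfl⟩ := hs3 f hf
      exact ⟨![c1, c2, c3, c4, c5, c6], by simp [Fin.sum_univ_six]; abel⟩
    · intro i j hij
      fin_cases i <;> fin_cases j <;>
        first
        | exact absurd hij (by decide)
        | simp [Fin.sum_univ_six, shortTwoGenAlg_apply, *]
  exact hiso.isMalcev (isMalcev_shortTwoGenAlg (hiso.symm.isBinaryLie hb))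

/-- With u = [x,y] and v = [x,u], the binary Lie identities put [y,v] and [u,v] into `lcs μ 4`.
Hence [x,v] alone spans `lcs μ 3` modulo `lcs μ 4`, which excludes type (2,1,1,2) and leaves
(2,1,1,1,1). -/
theorem isMalcev_of_pair_of_mul_mem (hb : IsBinaryLie μ) (h0 : ∀ x, μ x x = 0)
    (hn : IsNilpotentAlg μ) (hd : Module.finrank F A = 6)
    (h3 : Module.finrank F (lcs μ 3) = 2) {x y : A}
    (hs : ∀ t, ∃ a b : F, ∃ r ∈ lcs μ 1, t = a • x + b • y + r)
    (hyu : μ y (μ x y) ∈ lcs μ 3) : IsMalcev μ := by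
  have h := hb.1
  have hs1 := fun t ht => exists_of_mem_lcs_one_of_pair h h0 hs (t := t) ht
  have hs2 : ∀ t ∈ lcs μ 2, ∃ c : F, ∃ r ∈ lcs μ 3, t = c • μ x (μ x y) + r := by
    intro t ht
    obtain ⟨a, b, r, hr, rfl⟩ := exists_of_mem_lcs_two_of_pair h h0 hs ht
    exact ⟨a, _, add_mem (Submodule.smul_mem _ b hyu) hr, by module⟩
  have hu1 := mul_mem_lcs_one μ x y
  obtain ⟨u, hu⟩ : ∃ u, μ x y = u := ⟨_, rfl⟩
  obtain ⟨v, hv⟩ : ∃ v, μ x u = v := ⟨_, rfl⟩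
  rw [hu] at hu1 hs1 hs2 hyu
  rw [hv] at hs2
  have hv2 : v ∈ lcs μ 2 := hv ▸ mul_mem_lcs_succ x hu1
  have hux : μ u x = -v := by rw [h, hv]
  have hyv : μ y v ∈ lcs μ 4 := by
    have hJ := hb.2 x y
    rw [jacobian, hu, h0, hux, map_neg, LinearMap.neg_apply, h v y, neg_neg, add_zero] at hJ
    rw [eq_neg_of_add_eq_zero_left hJ]
    exact neg_mem (h.mul_mem_lcs_succ x hyu)
  have huv : μ u v ∈ lcs μ 4 := by
    have hP := hb.polarized x y u
    have j1 : jacobian μ u x u = 0 := by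
      rw [jacobian, h0, hux, hv, map_neg, LinearMap.neg_apply]
      simp
    rw [hu, hv, j1, zero_add, jacobian, hu] at hP
    have e : μ u v = -(μ (μ v x) y + μ (μ y v) x) := by
      rw [eq_neg_iff_add_eq_zero, ← hP]
      abel
    rw [e]
    exact neg_mem (add_mem (h.mul_mem_lcs_succ y (h.mul_mem_lcs_succ x hv2))
      (lcs_succ_le μ 4 (h.mul_mem_lcs_succ x hyv)))
  have hle : lcs μ 3 ≤ Submodule.span F {μ x v} ⊔ lcs μ 4 := by
    refine lcs_succ_le_iff.mpr fun p q hq => ?_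
    obtain ⟨a, b, r, hr, rfl⟩ := hs p
    obtain ⟨c, s, hs', rfl⟩ := hs1 r hr
    obtain ⟨d, t, ht, rfl⟩ := hs2 q hq
    obtain ⟨f, g, hg, rfl⟩ := hs2 s hs'
    refine Submodule.mem_sup.mpr ⟨(d * a) • μ x v, Submodule.mem_span_singleton.mpr ⟨_, rfl⟩,
      μ (a • x + b • y + (c • u + (f • v + g))) t + (d * b) • μ y v + (d * c) • μ u v +
        d • μ g v,
      add_mem (add_mem (add_mem (mul_mem_lcs_succ _ ht) (Submodule.smul_mem _ _ hyv))
        (Submodule.smul_mem _ _ huv)) (Submodule.smul_mem _ _ (h.mul_mem_lcs_succ _ hg)), ?_⟩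
    simp only [map_add, map_smul, LinearMap.add_apply, LinearMap.smul_apply, h0]
    module
  have hs3 : ∀ t ∈ lcs μ 3, ∃ c : F, ∃ r ∈ lcs μ 4, t = c • μ x v + r := by
    intro t ht
    obtain ⟨p, hp, r, hr, rfl⟩ := Submodule.mem_sup.mp (hle ht)
    obtain ⟨c, rfl⟩ := Submodule.mem_span_singleton.mp hp
    exact ⟨c, r, hr, rfl⟩
  have hf3 := hn.finrank_lcs_succ_lt (n := 3) (Submodule.one_le_finrank_iff.mp (by omega))
  have hf3' := finrank_le_succ_of_forall hs3
  have h4 : Module.finrank F (lcs μ 4) = 1 := by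
    simp only [Nat.reduceAdd] at hf3
    omega
  have h5 : lcs μ 5 = ⊥ := by
    have hf4 := hn.finrank_lcs_succ_lt (n := 4) (Submodule.one_le_finrank_iff.mp (by omega))
    simp only [Nat.reduceAdd] at hf4
    exact Submodule.finrank_eq_zero.mp (by omega)
  obtain ⟨c, hc⟩ : ∃ c, μ x v = c := ⟨_, rfl⟩
  rw [hc] at hs3
  have hc3 : c ∈ lcs μ 3 := hc ▸ mul_mem_lcs_succ x hv2
  obtain ⟨w, hw, hw0⟩ := exists_mem_notMem_of_finrank_lt (U := ⊥) (V := lcs μ 4) (by simp [h4])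
  have hs4 : ∀ t ∈ lcs μ 4, ∃ c : F, t = c • w := fun t ht =>
    exists_smul_of_finrank_le_one h4.le hw (by simpa using hw0) ht
  have hw' : ∀ t, μ t w = 0 := fun t => mul_eq_zero_of_lcs_eq_bot h5 t hw
  obtain ⟨b, r, hr, hyu'⟩ := hs3 _ hyu
  obtain ⟨b', rfl⟩ := hs4 r hr
  obtain ⟨s, hs'⟩ := hs4 _ (mul_mem_lcs_succ x hc3)
  obtain ⟨m, hm⟩ := hs4 _ hyv
  obtain ⟨t, ht⟩ := hs4 _ (mul_mem_lcs_succ y hc3)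
  obtain ⟨f, hf⟩ := hs4 _ huv
  obtain ⟨k, hk⟩ := hs4 _ (mul_mem_lcs_succ u hc3)
  obtain ⟨l, hl⟩ := hs4 _ (mul_mem_lcs_succ v hc3)
  have hiso : AlgIso μ (longTwoGenAlg b b' s m t f k l) := by
    refine algIso_of_table h h0 (isAnticomm_longTwoGenAlg b b' s m t f k l)
      (longTwoGenAlg_self b b' s m t f k l) hd ![x, y, u, v, c, w] ?_ ?_
    · intro t
      obtain ⟨c1, c2, r, hr, rfl⟩ := hs t
      obtain ⟨c3, g, hg, rfl⟩ := hs1 r hr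
      obtain ⟨c4, f, hf, rfl⟩ := hs2 g hg
      obtain ⟨c5, d, hd, rfl⟩ := hs3 f hf
      obtain ⟨c6, rfl⟩ := hs4 d hd
      exact ⟨![c1, c2, c3, c4, c5, c6], by simp [Fin.sum_univ_six]; abel⟩
    · intro i j hij
      fin_cases i <;> fin_cases j <;>
        first
        | exact absurd hij (by decide)
        | simp [Fin.sum_univ_six, longTwoGenAlg_apply, *]
  exact hiso.isMalcev (isMalcev_longTwoGenAlg (hiso.symm.isBinaryLie hb))

theorem isMalcev_of_pair_of_mul_notMem (hb : IsBinaryLie μ) (h0 : ∀ x, μ x x = 0)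
    (hn : IsNilpotentAlg μ) (hd : Module.finrank F A = 6)
    (h2 : Module.finrank F (lcs μ 2) = 3) (h3 : Module.finrank F (lcs μ 3) = 2) {x y : A}
    (hs : ∀ t, ∃ a b : F, ∃ r ∈ lcs μ 1, t = a • x + b • y + r)
    (hxu : μ x (μ x y) ∉ lcs μ 3) : IsMalcev μ := by
  obtain ⟨c, r, hr, hc⟩ := exists_smul_add_of_finrank_le (U := lcs μ 3) (lcs_succ_le μ 2)
    (by omega) (mul_mem_lcs_succ x (mul_mem_lcs_one μ x y)) hxu
    (mul_mem_lcs_succ y (mul_mem_lcs_one μ x y))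
  refine isMalcev_of_pair_of_mul_mem hb h0 hn hd h3 (x := x) (y := y - c • x) ?_ ?_
  · intro t
    obtain ⟨a, b, s, hs', rfl⟩ := hs t
    exact ⟨a + b * c, b, s, hs', by module⟩
  · rw [map_sub (μ x), map_smul, h0, smul_zero, sub_zero, map_sub, map_smul, LinearMap.sub_apply,
      LinearMap.smul_apply, hc, add_sub_cancel_left]
    exact hr

theorem isMalcev_of_finrank_lcs_one_eq_four (hb : IsBinaryLie μ) (h0 : ∀ x, μ x x = 0)
    (hn : IsNilpotentAlg μ) (hd : Module.finrank F A = 6)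
    (h1 : Module.finrank F (lcs μ 1) = 4) : IsMalcev μ := by
  have h := hb.1
  obtain ⟨x, -, y, -, hs⟩ := exists_pair_of_finrank_eq (U := lcs μ 1)
    (V := (⊤ : Submodule F A)) le_top (by rw [finrank_top, hd, h1])
  replace hs := fun t => hs t Submodule.mem_top
  have hs1 := fun t ht => exists_of_mem_lcs_one_of_pair h h0 hs (t := t) ht
  have hf1 := hn.finrank_lcs_succ_lt (n := 1) (Submodule.one_le_finrank_iff.mp (by omega))
  have hf1' := finrank_le_succ_of_forall hs1
  have h2 : Module.finrank F (lcs μ 2) = 3 := by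
    simp only [Nat.reduceAdd] at hf1
    omega
  have hf2 := hn.finrank_lcs_succ_lt (n := 2) (Submodule.one_le_finrank_iff.mp (by omega))
  simp only [Nat.reduceAdd] at hf2
  obtain h3 | h3 | h3 : Module.finrank F (lcs μ 3) = 0 ∨ Module.finrank F (lcs μ 3) = 1 ∨
    Module.finrank F (lcs μ 3) = 2 := by omega
  · have h3' : lcs μ 3 = ⊥ := Submodule.finrank_eq_zero.mp h3
    refine isMalcev_of_lcs_three_eq_bot h h3' fun p hp q hq => ?_
    obtain ⟨a, r, hr, rfl⟩ := hs1 p hp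
    obtain ⟨b, s, hs', rfl⟩ := hs1 q hq
    simp [h0, mul_eq_zero_of_lcs_eq_bot h3' _ hs', h.mul_eq_zero_of_lcs_eq_bot h3' _ hr]
  · have hf3 := hn.finrank_lcs_succ_lt (n := 3) (Submodule.one_le_finrank_iff.mp (by omega))
    simp only [Nat.reduceAdd] at hf3
    exact isMalcev_of_pair_of_finrank_eq_one hb h0 hd h3
      (Submodule.finrank_eq_zero.mp (by omega)) hs
  · by_cases hxu : μ x (μ x y) ∈ lcs μ 3
    · by_cases hyu : μ y (μ x y) ∈ lcs μ 3
      · have hle : lcs μ 2 ≤ lcs μ 3 := by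
          intro t ht
          obtain ⟨a, b, r, hr, rfl⟩ := exists_of_mem_lcs_two_of_pair h h0 hs ht
          exact add_mem (add_mem (Submodule.smul_mem _ _ hxu) (Submodule.smul_mem _ _ hyu)) hr
        have := Submodule.finrank_mono hle
        omega
      · refine isMalcev_of_pair_of_mul_notMem hb h0 hn hd h2 h3 (x := y) (y := x) ?_ ?_
        · intro t
          obtain ⟨a, b, r, hr, rfl⟩ := hs t
          exact ⟨b, a, r, hr, by abel⟩
        · rwa [h y x, map_neg, neg_mem_iff]
    · exact isMalcev_of_pair_of_mul_notMem hb h0 hn hd h2 h3 hs hxu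

/-- A single generator x has [x,x] = 0, so `lcs μ 1` would lie in `lcs μ 2` and the series would
stall. -/
theorem finrank_lcs_one_le_four (h : IsAnticomm μ) (h0 : ∀ x, μ x x = 0) (hn : IsNilpotentAlg μ)
    (hd : Module.finrank F A = 6) : Module.finrank F (lcs μ 1) ≤ 4 := by
  by_contra! hc
  obtain ⟨x, -, hx⟩ : ∃ x ∈ (⊤ : Submodule F A), x ∉ lcs μ 1 := by
    by_contra! hall
    have he : lcs μ 1 = lcs μ 0 := top_le_iff.mp hall
    have h00 := hn.lcs_eq_bot he
    rw [he, h00, finrank_bot] at hc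
    omega
  have hs : ∀ t, ∃ a : F, ∃ r ∈ lcs μ 1, t = a • x + r := fun t =>
    exists_smul_add_of_finrank_le (U := lcs μ 1) (V := ⊤) le_top
      (by rw [finrank_top]; omega) Submodule.mem_top hx Submodule.mem_top
  have hle : lcs μ 1 ≤ lcs μ 2 := by
    intro t ht
    obtain ⟨c, r, hr, rfl⟩ := exists_of_mem_lcs_one_of_pair h h0 (x := x) (y := 0)
      (fun t => by
        obtain ⟨a, r, hr, rfl⟩ := hs t
        exact ⟨a, 0, r, hr, by module⟩) ht
    simpa using hr
  have hbot := hn.lcs_eq_bot (le_antisymm (lcs_succ_le μ 1) hle)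
  rw [hbot, finrank_bot] at hc
  omega

/-- Here `lcs μ 1` is spanned by one element and the central subspace `lcs μ 2`, so its
multiplication is zero. -/
theorem isMalcev_of_finrank_lcs_one_le (h : IsAnticomm μ) (h0 : ∀ x, μ x x = 0)
    (h3 : lcs μ 3 = ⊥) (hf : Module.finrank F (lcs μ 1) ≤ Module.finrank F (lcs μ 2) + 1) :
    IsMalcev μ := by
  refine isMalcev_of_lcs_three_eq_bot h h3 fun p hp q hq => ?_
  have hr : ∀ t, ∀ r ∈ lcs μ 2, μ t r = 0 := fun t r hr => mul_eq_zero_of_lcs_eq_bot h3 t hr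
  have hl : ∀ t, ∀ r ∈ lcs μ 2, μ r t = 0 := fun t r hr => h.mul_eq_zero_of_lcs_eq_bot h3 t hr
  by_cases hp2 : p ∈ lcs μ 2
  · exact hl q p hp2
  · obtain ⟨c, r, hr', rfl⟩ := exists_smul_add_of_finrank_le (U := lcs μ 2) (lcs_succ_le μ 1) hf
      hp hp2 hq
    rw [map_add, map_smul, h0, hr _ _ hr', smul_zero, add_zero]

theorem exists_algIso_of_isNilpotentNonMalcevSix (hF : ringChar F ≠ 2)
    (hμ : IsNilpotentNonMalcevSix μ) :
    (∃ α : F, AlgIso μ (B61 F α)) ∨ AlgIso μ (B62 F) ∨ AlgIso μ (B63 F) := by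
  obtain ⟨hd, hb, hn, hM⟩ := hμ
  have h := hb.1
  have h0 := h.self_eq_zero hF
  have hf0 := finrank_lcs_one_le_four h h0 hn hd
  have hf1 : Module.finrank F (lcs μ 1) ≠ 4 := fun h1 =>
    hM (isMalcev_of_finrank_lcs_one_eq_four hb h0 hn hd h1)
  have hlt : ∀ n, Module.finrank F (lcs μ n) = 0 ∧ Module.finrank F (lcs μ (n + 1)) = 0 ∨
      Module.finrank F (lcs μ (n + 1)) < Module.finrank F (lcs μ n) := by
    intro n
    by_cases hz : lcs μ n = ⊥
    · have hz' : lcs μ (n + 1) = ⊥ := le_bot_iff.mp (hz ▸ lcs_succ_le μ n)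
      left
      rw [hz, hz']
      simp
    · exact Or.inr (hn.finrank_lcs_succ_lt hz)
  have l1 := hlt 1
  have l2 := hlt 2
  have l3 := hlt 3
  simp only [Nat.reduceAdd] at l1 l2 l3
  -- The dimensions of `lcs μ 1`, `lcs μ 2`, … can now only be 3, 1, 0 or 3, 2, 1, 0, once the
  -- Malcev cases are discarded.
  by_cases h3 : Module.finrank F (lcs μ 3) = 0
  · have h3' : lcs μ 3 = ⊥ := Submodule.finrank_eq_zero.mp h3
    have hf : ¬ Module.finrank F (lcs μ 1) ≤ Module.finrank F (lcs μ 2) + 1 := fun hf =>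
      hM (isMalcev_of_finrank_lcs_one_le h h0 h3' hf)
    by_cases h2 : Module.finrank F (lcs μ 2) = 0
    · have h2' : lcs μ 2 = ⊥ := Submodule.finrank_eq_zero.mp h2
      exact absurd (isMalcev_of_lcs_three_eq_bot h h3' fun p _ q hq =>
        mul_eq_zero_of_lcs_eq_bot h2' p hq) hM
    · exact Or.inl (algIso_B61_of_finrank h h0 hM hd (by omega) (by omega) h3')
  · exact Or.inr (algIso_B62_or_B63_of_finrank hb h0 hM hd (by omega) (by omega) (by omega)
      (Submodule.finrank_eq_zero.mp (by omega)))

end TwoGenerators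

end BinaryLie

theorem theorem2 {F : Type u} [Field F] (hF : ringChar F ≠ 2) :
    -- every algebra of the class is isomorphic to a listed one
    (∀ (A : Type v) [AddCommGroup A] [Module F A] (μ : A →ₗ[F] A →ₗ[F] A),
      BinaryLie.IsNilpotentNonMalcevSix μ →
        (∃ α : F, BinaryLie.AlgIso μ (BinaryLie.B61 F α)) ∨
          BinaryLie.AlgIso μ (BinaryLie.B62 F) ∨ BinaryLie.AlgIso μ (BinaryLie.B63 F)) ∧
    -- the listed algebras belong to the class
    (∀ α : F, BinaryLie.IsNilpotentNonMalcevSix (BinaryLie.B61 F α)) ∧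
    BinaryLie.IsNilpotentNonMalcevSix (BinaryLie.B62 F) ∧
    BinaryLie.IsNilpotentNonMalcevSix (BinaryLie.B63 F) ∧
    -- the isomorphisms among the listed algebras
    (∀ α β : F, BinaryLie.AlgIso (BinaryLie.B61 F α) (BinaryLie.B61 F β) ↔
      ∃ c : F, c ≠ 0 ∧ β = c ^ 2 * α) ∧
    (∀ α : F, ¬ BinaryLie.AlgIso (BinaryLie.B61 F α) (BinaryLie.B62 F)) ∧
    (∀ α : F, ¬ BinaryLie.AlgIso (BinaryLie.B61 F α) (BinaryLie.B63 F)) ∧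
    ¬ BinaryLie.AlgIso (BinaryLie.B62 F) (BinaryLie.B63 F) := by
  refine ⟨fun A _ _ μ hμ => ?_, BinaryLie.isNilpotentNonMalcevSix_B61,
    BinaryLie.isNilpotentNonMalcevSix_B62, BinaryLie.isNilpotentNonMalcevSix_B63,
    BinaryLie.algIso_B61_iff, BinaryLie.not_algIso_B61_B62, BinaryLie.not_algIso_B61_B63,
    BinaryLie.not_algIso_B62_B63⟩
  -- `Module.finrank` is 0 for infinite-dimensional spaces, so the value 6 forces finite dimension.
  have : FiniteDimensional F A :=
    Module.finite_of_finrank_pos (by rw [hμ.finrank_eq]; norm_num)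
  exact BinaryLie.exists_algIso_of_isNilpotentNonMalcevSix hF hμ
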